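/- Fix an integer $d\ge 2$, let $A=\{1,\dots,d\}$, and let $\sigma$ be the left shift $\sigma(x)_n=x_{n+1}$ on $A^{\mathbb Z}$. For a nonempty word $v\in A^m$ and a rational $\alpha>1$ with $\alpha m\in\mathbb N$, the $\alpha$-power $v^\alpha$ is the word formed by the first $\alpha m$ symbols of $vvv\cdots$. For real $\beta>1$ let $X^d_\beta$ (respectively $X^d_{\beta^+}$) be the set of all $x\in A^{\mathbb Z}$ such that no finite subword of $x$ is an $\alpha$-power for a rational $\alpha\ge\beta$ (respectively $\alpha>\beta$). For such a shift space $X$, let $\mathcal L_n$ be the set of words of length $n$ that occur in elements of $X$, and for $w\in\mathcal L_n$ let $[w]=\{x\in X: x_1\cdots x_n=w\}$. The entropy of a $\sigma$-invariant Borel probability measure $\mu$ on $X$ is $$h_\mu=\lim_{n\to\infty}\frac1n\sum_{w\in\mathcal L_n}-\mu([w])\log\mu([w]),$$ with the convention $0\log 0=0$, and $\mu$ is a measure of maximal entropy if $h_\mu\ge h_\nu$ for every $\sigma$-invariant Borel probability measure $\nu$ on $X$. Theorem. Let $d\ge 2$ be an integer and $\beta$ a real number. 1. If $\beta>12$, or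 if $d\ge3$ and $\beta=12$, then $X^d_\beta$ has exactly one measure of maximal entropy. 2. If $\beta\ge 12$, then $X^d_{\beta^+}$ has exactly one measure of maximal entropy. -/

import Mathlib

open MeasureTheory Filter SymbolicDynamics.FullShift

namespace PowerFree

/-- The word `x_i x_{i+1} ⋯ x_{i+n-1}` of length `n` that occurs in `x` at position `i`. Words of
length `n` over the alphabet `{0, …, d - 1}` are functions `Fin n → Fin d`. -/
def word {d : ℕ} (x : ℤ → Fin d) (i : ℤ) (n : ℕ) : Fin n → Fin d :=
  fun k => x (i + (k : ℕ))

/-- The shift space of all bi-infinite strings none of whose subwords is forbidden, where `F n` is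
the set of forbidden words of length `n`. -/
def shiftSpace {d : ℕ} (F : (n : ℕ) → Set (Fin n → Fin d)) : Subshift (Fin d) ℤ where
  carrier := {x | ∀ (i : ℤ) (n : ℕ), word x i n ∉ F n}
  isClosed := by
    simp only [Set.ofPred_forall]
    refine isClosed_iInter fun i => isClosed_iInter fun n => ?_
    have hc : Continuous fun x : ℤ → Fin d => word x i n := by
      unfold word
      fun_prop
    exact (isClosed_discrete (F n)ᶜ).preimage hc
  mapsTo := by
    intro g x hx i n
    have h : word (shift g x) i n = word x (g + i) n := by
      funext k
      simp [word, add_assoc]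
    rw [h]
    exact hx (g + i) n

/-- The first `n` symbols of the periodic string `v v v ⋯`. -/
def periodicWord {d m : ℕ} (hm : 0 < m) (v : Fin m → Fin d) (n : ℕ) : Fin n → Fin d :=
  fun k => v ⟨(k : ℕ) % m, Nat.mod_lt _ hm⟩

/-- The words of length `n` of the form `v ^ α` with `v` a nonempty word and `α ∈ S ∩ ℚ`. The
power `v ^ α` is defined when `α * |v|` is a natural number, which is then its length. -/
def powers (d : ℕ) (S : Set ℝ) (n : ℕ) : Set (Fin n → Fin d) :=
  {w | ∃ (m : ℕ) (hm : 0 < m) (v : Fin m → Fin d) (α : ℚ),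
    (α : ℝ) ∈ S ∧ α * (m : ℚ) = (n : ℚ) ∧ w = periodicWord hm v n}

/-- The `d`-ary `β`-free shift space: no subword is an `α`-power with `α ≥ β`. -/
def freeShift (d : ℕ) (β : ℝ) : Subshift (Fin d) ℤ :=
  shiftSpace (powers d (Set.Ici β))

/-- The `d`-ary `β⁺`-free shift space: no subword is an `α`-power with `α > β`. -/
def freeShiftPlus (d : ℕ) (β : ℝ) : Subshift (Fin d) ℤ :=
  shiftSpace (powers d (Set.Ioi β))

variable {d : ℕ} (X : Subshift (Fin d) ℤ)

/-- The left shift `σ(x)_n = x_{n+1}` as a map from `X` to itself. -/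
def shiftMap : X.carrier → X.carrier :=
  (X.mapsTo 1).restrict _ _ _

/-- The words of length `n` in the language of `X`. -/
def language (n : ℕ) : Set (Fin n → Fin d) :=
  {w | ∃ x ∈ X.carrier, ∃ i : ℤ, word x i n = w}

/-- The cylinder `[w] = {x ∈ X : x_1 ⋯ x_n = w}`. -/
def cyl {n : ℕ} (w : Fin n → Fin d) : Set X.carrier :=
  {x | word x.1 1 n = w}

/-- The shift-invariant Borel probability measures on `X`. (The product σ-algebra, restricted to
`X`, is the Borel σ-algebra.) -/
def invariantMeasures : Set (ProbabilityMeasure X.carrier) :=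
  {μ | MeasurePreserving (shiftMap X) (μ : Measure X.carrier) (μ : Measure X.carrier)}

/-- The entropy `H_n(μ) = ∑_{w ∈ L_n} -μ[w] log μ[w]` of the partition into cylinders of
length `n`. -/
noncomputable def blockEntropy (μ : ProbabilityMeasure X.carrier) (n : ℕ) : ℝ :=
  ∑ w ∈ (Set.toFinite (language X n)).toFinset,
    -(μ : Measure X.carrier).real (cyl X w) * Real.log ((μ : Measure X.carrier).real (cyl X w))

/-- The measure-theoretic entropy `h_μ = lim H_n(μ) / n`. For invariant `μ` the limit exists, since
`n ↦ H_n(μ)` is subadditive. -/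
noncomputable def entropy (μ : ProbabilityMeasure X.carrier) : ℝ :=
  limUnder atTop fun n : ℕ => blockEntropy X μ n / n

/-- A measure of maximal entropy: an invariant measure that attains the supremum of `h_ν` over all
invariant measures `ν` on `X`. -/
def IsMME (μ : ProbabilityMeasure X.carrier) : Prop :=
  μ ∈ invariantMeasures X ∧ ∀ ν ∈ invariantMeasures X, entropy X ν ≤ entropy X μ

end PowerFree

namespace PowerFree

/-! ### Counting the words seen in a window -/

section Counting

variable {d : ℕ}

/-! Both kinds of shift arise by forbidding, for each period `m`, the words of length `ℓ m` with
period `m`, for some `ℓ` with `12 * m ≤ ℓ m`. The argument works for every such `ℓ`. Call a word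
free if it contains no forbidden word, and good if it neither starts nor ends with a fourth power.
Free words need not extend to points of the shift space, and only they are counted.

Growth: forbidden powers are so rare that adding a letter multiplies the number of free words by at
least `7 * d / 8` (`freeCount_succ`). Hence at least a third of the free words are good. A forbidden
power across the seam of two good free words would put a fourth power next to the seam, so good free
words concatenate freely. The number of free words is therefore both sub- and supermultiplicative up
to a constant, and lies between `κ ^ n` and `9 * κ ^ n` (`exists_growth_rate`).

Existence: a weak limit `μ` of averaged uniform distributions on free words is invariant and gives
each word of length `n` mass at most `81 / κ ^ n`, so its entropy is `log κ`, the largest possible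
value. There is also a lower bound for pairs of distant events (`exists_isGibbs`). To obtain it,
surround two good words by good fillers. A forbidden power would have to cover the middle filler and
a full period beside it, so that filler is determined by its surroundings. Fillers grow
exponentially in number, while few periods are possible, so most fillers work. A renewal argument
(`cnt_le_of_goodCores`) reduces arbitrary free words to good ones.

Uniqueness: the pair bound makes `μ` ergodic (`IsGibbs.ergodic`). An invariant measure of entropy at
least `log κ` cannot charge a `μ`-null set, since too few words would carry its mass
(`IsGibbs.absolutelyContinuous`). Being absolutely continuous with respect to an ergodic measure, it
equals `μ`. -/

theorem word_eq_iff {x y : ℤ → Fin d} {a : ℤ} {n : ℕ} :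
    word x a n = word y a n ↔ Set.EqOn x y (Set.Ico a (a + n)) := by
  constructor
  · intro h i hi
    have := congrFun h ⟨(i - a).toNat, by have := hi.1; have := hi.2; omega⟩
    have h2 : a + ((i - a).toNat : ℤ) = i := by have := hi.1; omega
    simp only [word] at this
    rwa [h2] at this
  · intro h
    funext k
    exact h ⟨by omega, by have := k.2; omega⟩

/-- Membership in `S` depends only on the coordinates in `[a, b)`. -/
def LocalOn (S : Set (ℤ → Fin d)) (a b : ℤ) : Prop :=
  ∀ ⦃x y⦄, Set.EqOn x y (Set.Ico a b) → x ∈ S → y ∈ S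

theorem LocalOn.mono {S : Set (ℤ → Fin d)} {a b a' b' : ℤ} (h : LocalOn S a b) (ha : a' ≤ a)
    (hb : b ≤ b') : LocalOn S a' b' :=
  fun _ _ hxy => h (hxy.mono (Set.Ico_subset_Ico ha hb))

theorem LocalOn.inter {S S' : Set (ℤ → Fin d)} {a b : ℤ} (h : LocalOn S a b)
    (h' : LocalOn S' a b) : LocalOn (S ∩ S') a b :=
  fun _ _ hxy hx => ⟨h hxy hx.1, h' hxy hx.2⟩

theorem LocalOn.compl {S : Set (ℤ → Fin d)} {a b : ℤ} (h : LocalOn S a b) : LocalOn Sᶜ a b :=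
  fun _ _ hxy hx hy => hx (h hxy.symm hy)

theorem localOn_univ (a b : ℤ) : LocalOn (Set.univ : Set (ℤ → Fin d)) a b :=
  fun _ _ _ _ => trivial

theorem LocalOn.shift_preimage {S : Set (ℤ → Fin d)} {a b : ℤ} (h : LocalOn S a b) (k : ℤ) :
    LocalOn (shift k ⁻¹' S) (k + a) (k + b) := by
  intro x y hxy hx
  refine h (x := shift k x) ?_ hx
  intro i hi
  exact hxy ⟨by linarith [hi.1], by linarith [hi.2]⟩

/-- The number of words that the elements of `S` display in the window `[a, a + n)`. -/
noncomputable def cnt (S : Set (ℤ → Fin d)) (a : ℤ) (n : ℕ) : ℕ :=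
  ((fun x => word x a n) '' S).ncard

theorem cnt_mono {S S' : Set (ℤ → Fin d)} (h : S ⊆ S') (a : ℤ) (n : ℕ) : cnt S a n ≤ cnt S' a n :=
  Set.ncard_le_ncard (Set.image_mono h) (Set.toFinite _)

theorem cnt_union_le (S S' : Set (ℤ → Fin d)) (a : ℤ) (n : ℕ) :
    cnt (S ∪ S') a n ≤ cnt S a n + cnt S' a n := by
  unfold cnt
  rw [Set.image_union]
  exact Set.ncard_union_le _ _

theorem cnt_empty (a : ℤ) (n : ℕ) : cnt (∅ : Set (ℤ → Fin d)) a n = 0 := by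
  simp [cnt]

theorem cnt_biUnion_le {ι : Type*} (s : Finset ι) (S : ι → Set (ℤ → Fin d)) (a : ℤ) (n : ℕ) :
    cnt (⋃ i ∈ s, S i) a n ≤ ∑ i ∈ s, cnt (S i) a n := by
  classical
  induction s using Finset.induction_on with
  | empty => simp [cnt_empty]
  | insert i s hi ih =>
    rw [Finset.set_biUnion_insert, Finset.sum_insert hi]
    exact (cnt_union_le _ _ _ _).trans (by omega)

theorem cnt_le_pow (S : Set (ℤ → Fin d)) (a : ℤ) (n : ℕ) : cnt S a n ≤ d ^ n := by
  refine (Set.ncard_le_ncard (Set.subset_univ _) (Set.toFinite _)).trans ?_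
  rw [Set.ncard_univ]
  simp

theorem cnt_zero_le (S : Set (ℤ → Fin d)) (a : ℤ) : cnt S a 0 ≤ 1 := by
  simpa using cnt_le_pow S a 0

theorem cnt_pos {S : Set (ℤ → Fin d)} (h : S.Nonempty) (a : ℤ) (n : ℕ) : 0 < cnt S a n :=
  (Set.ncard_pos (Set.toFinite _)).2 (h.image _)

/-- If the display in one window is determined by the displays in two others, then the count is
at most the product of the other counts. -/
theorem cnt_le_mul {S : Set (ℤ → Fin d)} {a b c : ℤ} {n k l : ℕ}
    (h : ∀ x ∈ S, ∀ y ∈ S, Set.EqOn x y (Set.Ico b (b + k)) → Set.EqOn x y (Set.Ico c (c + l)) →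
      Set.EqOn x y (Set.Ico a (a + n))) :
    cnt S a n ≤ cnt S b k * cnt S c l := by
  rcases S.eq_empty_or_nonempty with rfl | ⟨x₀, -⟩
  · simp [cnt_empty]
  have : Nonempty (ℤ → Fin d) := ⟨x₀⟩
  unfold cnt
  rw [← Set.ncard_prod]
  choose! g hg using fun (w : Fin n → Fin d) (hw : w ∈ (fun x => word x a n) '' S) => hw
  refine Set.ncard_le_ncard_of_injOn (fun w => (word (g w) b k, word (g w) c l)) ?_ ?_
    (Set.toFinite _)
  · intro w hw
    exact ⟨⟨_, (hg w hw).1, rfl⟩, ⟨_, (hg w hw).1, rfl⟩⟩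
  · intro w hw w' hw' hww
    rw [Prod.mk.injEq, word_eq_iff, word_eq_iff] at hww
    have := h _ (hg w hw).1 _ (hg w' hw').1 hww.1 hww.2
    rw [← word_eq_iff] at this
    rw [← (hg w hw).2, ← (hg w' hw').2]
    exact this

theorem cnt_le_of_determined {S : Set (ℤ → Fin d)} {a b : ℤ} {n k : ℕ}
    (h : ∀ x ∈ S, ∀ y ∈ S, Set.EqOn x y (Set.Ico b (b + k)) → Set.EqOn x y (Set.Ico a (a + n))) :
    cnt S a n ≤ cnt S b k := by
  have := cnt_le_mul (S := S) (a := a) (b := b) (c := 0) (n := n) (k := k) (l := 0)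
    (fun x hx y hy h1 _ => h x hx y hy h1)
  calc _ ≤ _ := this
    _ ≤ cnt S b k * 1 := Nat.mul_le_mul_left _ (cnt_zero_le _ _)
    _ = _ := mul_one _

theorem cnt_add_le (S : Set (ℤ → Fin d)) (a : ℤ) (n k : ℕ) :
    cnt S a (n + k) ≤ cnt S a n * cnt S (a + n) k := by
  refine cnt_le_mul fun x _ y _ h1 h2 i hi => ?_
  have := hi.1
  have := hi.2
  push_cast at this
  by_cases h : i < a + n
  · exact h1 ⟨by omega, h⟩
  · exact h2 ⟨by omega, by omega⟩

/-- Constraints on adjacent windows can be met independently. -/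
theorem mul_cnt_le_inter {S S' : Set (ℤ → Fin d)} {a : ℤ} {n k : ℕ}
    (h : LocalOn S a (a + n)) (h' : LocalOn S' (a + n) (a + n + k)) :
    cnt S a n * cnt S' (a + n) k ≤ cnt (S ∩ S') a (n + k) := by
  rcases S.eq_empty_or_nonempty with rfl | ⟨x₀, -⟩
  · simp [cnt_empty]
  have : Nonempty (ℤ → Fin d) := ⟨x₀⟩
  unfold cnt
  rw [← Set.ncard_prod]
  choose! g hg using fun (w : Fin n → Fin d) (hw : w ∈ (fun x => word x a n) '' S) => hw
  choose! g' hg' using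
    fun (w : Fin k → Fin d) (hw : w ∈ (fun x => word x (a + n) k) '' S') => hw
  let z : (Fin n → Fin d) × (Fin k → Fin d) → ℤ → Fin d :=
    fun p i => if i < a + n then g p.1 i else g' p.2 i
  have z1 : ∀ p, Set.EqOn (z p) (g p.1) (Set.Ico a (a + n)) := fun p i hi => by
    simp [z, hi.2]
  have z2 : ∀ p, Set.EqOn (z p) (g' p.2) (Set.Ico (a + n) (a + n + k)) := fun p i hi => by
    simp [z, not_lt.2 hi.1]
  refine Set.ncard_le_ncard_of_injOn (fun p => word (z p) a (n + k)) ?_ ?_ (Set.toFinite _)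
  · rintro ⟨w, w'⟩ ⟨hw, hw'⟩
    exact ⟨_, ⟨h (z1 (w, w')).symm (hg w hw).1, h' (z2 (w, w')).symm (hg' w' hw').1⟩, rfl⟩
  · rintro ⟨w, w'⟩ ⟨hw, hw'⟩ ⟨v, v'⟩ ⟨hv, hv'⟩ e
    simp only [word_eq_iff] at e
    push_cast at e
    have e1 : Set.EqOn (g w) (g v) (Set.Ico a (a + n)) :=
      (z1 (w, w')).symm.trans ((e.mono (Set.Ico_subset_Ico le_rfl (by omega))).trans (z1 (v, v')))
    have e2 : Set.EqOn (g' w') (g' v') (Set.Ico (a + n) (a + n + k)) :=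
      (z2 (w, w')).symm.trans
        ((e.mono (Set.Ico_subset_Ico (by omega) (by omega))).trans (z2 (v, v')))
    rw [← word_eq_iff] at e1 e2
    have a1 := (hg w hw).2
    have a2 := (hg v hv).2
    have a3 := (hg' w' hw').2
    have a4 := (hg' v' hv').2
    simp only at a1 a2 a3 a4
    rw [Prod.mk.injEq, ← a1, ← a2, ← a3, ← a4]
    exact ⟨e1, e2⟩

theorem cnt_shift_preimage (S : Set (ℤ → Fin d)) (k a : ℤ) (n : ℕ) :
    cnt (shift k ⁻¹' S) (k + a) n = cnt S a n := by
  unfold cnt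
  congr 1
  ext w
  constructor
  · rintro ⟨x, hx, rfl⟩
    refine ⟨shift k x, hx, ?_⟩
    funext i
    simp [word, add_assoc]
  · rintro ⟨x, hx, rfl⟩
    refine ⟨shift (-k) x, by simpa [← shift_add] using hx, ?_⟩
    funext i
    simp [word, ← add_assoc]

theorem le_cnt_univ_one (a : ℤ) : d ≤ cnt (Set.univ : Set (ℤ → Fin d)) a 1 := by
  unfold cnt
  have : (fun x : ℤ → Fin d => word x a 1) '' Set.univ = Set.univ := by
    ext w
    simp only [Set.image_univ, Set.mem_range, Set.mem_univ, iff_true]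
    exact ⟨fun _ => w 0, by funext k; simp [word, Subsingleton.elim k 0]⟩
  rw [this, Set.ncard_univ]
  simp

end Counting

/-! ### Periodic stretches, free words and good words -/

section Periods

variable {d : ℕ}

/-- The restriction of `x` to `[s, t)` has period `m`. -/
def HasPeriodOn (x : ℤ → Fin d) (m : ℕ) (s t : ℤ) : Prop :=
  ∀ i, s ≤ i → i + m < t → x i = x (i + m)

theorem HasPeriodOn.mono {x : ℤ → Fin d} {m : ℕ} {s t s' t' : ℤ} (h : HasPeriodOn x m s t)
    (hs : s ≤ s') (ht : t' ≤ t) : HasPeriodOn x m s' t' :=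
  fun i hi hi' => h i (hs.trans hi) (hi'.trans_le ht)

theorem HasPeriodOn.congr {x y : ℤ → Fin d} {m : ℕ} {s t : ℤ} (h : HasPeriodOn x m s t)
    (e : Set.EqOn x y (Set.Ico s t)) : HasPeriodOn y m s t := by
  intro i hi hit
  rw [← e ⟨hi, by omega⟩, ← e ⟨by omega, hit⟩]
  exact h i hi hit

/-- A periodic display is determined by its first period. -/
theorem HasPeriodOn.eqOn_of_left {x y : ℤ → Fin d} {m : ℕ} {s t : ℤ} (hm : 0 < m)
    (hx : HasPeriodOn x m s t) (hy : HasPeriodOn y m s t)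
    (e : Set.EqOn x y (Set.Ico s (s + m))) : Set.EqOn x y (Set.Ico s t) := by
  have key : ∀ n : ℕ, s + n < t → x (s + n) = y (s + n) := by
    intro n
    induction n using Nat.strong_induction_on with
    | _ n ih =>
      intro hn
      by_cases h : n < m
      · exact e ⟨by omega, by omega⟩
      · have h1 := hx (s + n - m) (by omega) (by omega)
        have h2 := hy (s + n - m) (by omega) (by omega)
        have h3 := ih (n - m) (by omega) (by omega)
        have e1 : s + n - m = s + ((n - m : ℕ) : ℤ) := by omega
        rw [sub_add_cancel] at h1 h2
        rw [← h1, ← h2, e1, h3]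
  intro i hi
  have := hi.1
  have h := key (i - s).toNat (by have := hi.2; omega)
  rwa [show s + ((i - s).toNat : ℤ) = i by omega] at h

/-- A periodic display is determined by its last period. -/
theorem HasPeriodOn.eqOn_of_right {x y : ℤ → Fin d} {m : ℕ} {s t : ℤ} (hm : 0 < m)
    (hx : HasPeriodOn x m s t) (hy : HasPeriodOn y m s t)
    (e : Set.EqOn x y (Set.Ico (t - m) t)) : Set.EqOn x y (Set.Ico s t) := by
  have key : ∀ n : ℕ, s ≤ t - 1 - n → x (t - 1 - n) = y (t - 1 - n) := by
    intro n
    induction n using Nat.strong_induction_on with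
    | _ n ih =>
      intro hn
      by_cases h : n < m
      · exact e ⟨by omega, by omega⟩
      · have h1 := hx (t - 1 - n) (by omega) (by omega)
        have h2 := hy (t - 1 - n) (by omega) (by omega)
        have h3 := ih (n - m) (by omega) (by omega)
        have e1 : t - 1 - n + m = t - 1 - ((n - m : ℕ) : ℤ) := by omega
        rw [h1, h2, e1, h3]
  intro i hi
  have := hi.2
  have h := key (t - 1 - i).toNat (by have := hi.1; omega)
  rwa [show t - 1 - ((t - 1 - i).toNat : ℤ) = i by omega] at h

/-- The display of `x` in `[a, b)` contains no word of length `ℓ m` with period `m`. -/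
def FreeOn (ℓ : ℕ → ℕ) (x : ℤ → Fin d) (a b : ℤ) : Prop :=
  ∀ m : ℕ, 0 < m → ∀ s, a ≤ s → s + ℓ m ≤ b → ¬ HasPeriodOn x m s (s + ℓ m)

/-- The display of `x` in `[a, b)` has no prefix that is a fourth power. -/
def PrefixGoodOn (x : ℤ → Fin d) (a b : ℤ) : Prop :=
  ∀ m : ℕ, 0 < m → a + 4 * m ≤ b → ¬ HasPeriodOn x m a (a + 4 * m)

/-- The display of `x` in `[a, b)` has no suffix that is a fourth power. -/
def SuffixGoodOn (x : ℤ → Fin d) (a b : ℤ) : Prop :=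
  ∀ m : ℕ, 0 < m → a ≤ b - 4 * m → ¬ HasPeriodOn x m (b - 4 * m) b

theorem FreeOn.mono {ℓ : ℕ → ℕ} {x : ℤ → Fin d} {a b a' b' : ℤ} (h : FreeOn ℓ x a b)
    (ha : a ≤ a') (hb : b' ≤ b) : FreeOn ℓ x a' b' :=
  fun m hm s hs ht => h m hm s (ha.trans hs) (ht.trans hb)

theorem PrefixGoodOn.mono {x : ℤ → Fin d} {a b b' : ℤ} (h : PrefixGoodOn x a b)
    (hb : b' ≤ b) : PrefixGoodOn x a b' :=
  fun m hm ht => h m hm (ht.trans hb)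

/-- The points whose display in `[a, b)` is free. -/
def freeSet (d : ℕ) (ℓ : ℕ → ℕ) (a b : ℤ) : Set (ℤ → Fin d) := {x | FreeOn ℓ x a b}

/-- The points whose display in `[a, b)` neither starts nor ends with a fourth power. -/
def goodSet (d : ℕ) (a b : ℤ) : Set (ℤ → Fin d) := {x | PrefixGoodOn x a b ∧ SuffixGoodOn x a b}

theorem localOn_freeSet (ℓ : ℕ → ℕ) (a b : ℤ) : LocalOn (freeSet d ℓ a b) a b :=
  fun _ _ e hx m hm s hs ht h =>
    hx m hm s hs ht (h.congr (e.symm.mono (Set.Ico_subset_Ico hs ht)))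

theorem localOn_prefixGood (a b : ℤ) :
    LocalOn {x : ℤ → Fin d | PrefixGoodOn x a b} a b :=
  fun _ _ e hx m hm ht h =>
    hx m hm ht (h.congr (e.symm.mono (Set.Ico_subset_Ico le_rfl ht)))

theorem localOn_suffixGood (a b : ℤ) :
    LocalOn {x : ℤ → Fin d | SuffixGoodOn x a b} a b :=
  fun _ _ e hx m hm ht h =>
    hx m hm ht (h.congr (e.symm.mono (Set.Ico_subset_Ico ht le_rfl)))

theorem localOn_goodSet (a b : ℤ) : LocalOn (goodSet d a b) a b :=
  (localOn_prefixGood a b).inter (localOn_suffixGood a b)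

theorem HasPeriodOn.shift_iff {x : ℤ → Fin d} {m : ℕ} {s t k : ℤ} :
    HasPeriodOn (shift k x) m s t ↔ HasPeriodOn x m (k + s) (k + t) := by
  constructor
  · intro h i hi hi'
    have := h (i - k) (by linarith) (by linarith)
    simpa [← add_assoc] using this
  · intro h i hi hi'
    have := h (k + i) (by linarith) (by linarith)
    simpa [add_assoc] using this

theorem shift_preimage_freeSet (ℓ : ℕ → ℕ) (k a b : ℤ) :
    shift k ⁻¹' freeSet d ℓ a b = freeSet d ℓ (k + a) (k + b) := by
  ext x
  simp only [freeSet, Set.mem_preimage, Set.mem_ofPred_eq, FreeOn, HasPeriodOn.shift_iff]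
  constructor
  · intro h m hm s hs ht
    have := h m hm (s - k) (by linarith) (by linarith)
    simpa [← add_assoc] using this
  · intro h m hm s hs ht
    have := h m hm (k + s) (by linarith) (by linarith)
    simpa [add_assoc] using this

theorem shift_preimage_goodSet (k a b : ℤ) :
    shift k ⁻¹' goodSet d a b = goodSet d (k + a) (k + b) := by
  ext x
  simp only [goodSet, Set.mem_preimage, Set.mem_ofPred_eq, PrefixGoodOn, SuffixGoodOn,
    HasPeriodOn.shift_iff]
  refine and_congr (forall_congr' fun m => forall_congr' fun hm => ?_)
    (forall_congr' fun m => forall_congr' fun hm => ?_)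
  · rw [add_assoc, add_le_add_iff_left]
  · rw [add_sub_assoc, add_le_add_iff_left]

end Periods

/-! ### Exponential growth of the number of free words -/

section Growth

variable {d : ℕ} {ℓ : ℕ → ℕ}

/-- The number of free words of length `n`. -/
noncomputable def freeCount (d : ℕ) (ℓ : ℕ → ℕ) (n : ℕ) : ℕ := cnt (freeSet d ℓ 0 n) 0 n

/-- The number of free words of length `n` that neither start nor end with a fourth power. -/
noncomputable def goodCount (d : ℕ) (ℓ : ℕ → ℕ) (n : ℕ) : ℕ :=
  cnt (freeSet d ℓ 0 n ∩ goodSet d 0 n) 0 n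

theorem cnt_freeSet (a : ℤ) (n : ℕ) : cnt (freeSet d ℓ a (a + n)) a n = freeCount d ℓ n := by
  have := cnt_shift_preimage (freeSet d ℓ 0 n) a 0 n
  rwa [shift_preimage_freeSet, add_zero] at this

theorem cnt_freeSet_inter_goodSet (a : ℤ) (n : ℕ) :
    cnt (freeSet d ℓ a (a + n) ∩ goodSet d a (a + n)) a n = goodCount d ℓ n := by
  have := cnt_shift_preimage (freeSet d ℓ 0 n ∩ goodSet d 0 n) a 0 n
  rwa [Set.preimage_inter, shift_preimage_freeSet, shift_preimage_goodSet, add_zero] at this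

theorem freeSet_anti {a b a' b' : ℤ} (ha : a ≤ a') (hb : b' ≤ b) :
    freeSet d ℓ a b ⊆ freeSet d ℓ a' b' :=
  fun _ hx => FreeOn.mono hx ha hb

theorem freeCount_add_le (n k : ℕ) :
    freeCount d ℓ (n + k) ≤ freeCount d ℓ n * freeCount d ℓ k := by
  rw [← cnt_freeSet (n : ℤ) k]
  refine (cnt_add_le _ _ _ _).trans (Nat.mul_le_mul (cnt_mono (freeSet_anti le_rfl ?_) _ _) ?_)
  · push_cast; omega
  · rw [zero_add]
    refine cnt_mono (freeSet_anti ?_ ?_) _ _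
    · omega
    · push_cast; omega

/-- Append an arbitrary letter to a free word. If the result is not free, it ends in a stretch of
length `12 * m` with period `m`, whose last `11 * m` letters are determined by its first period and
can be erased. -/
theorem mul_freeCount_le (hℓ : ∀ m, 0 < m → 12 * m ≤ ℓ m) (n : ℕ) :
    d * freeCount d ℓ n ≤ freeCount d ℓ (n + 1) +
      ∑ m ∈ Finset.Icc 1 ((n + 1) / 12), freeCount d ℓ (n + 1 - 11 * m) := by
  let Q : ℕ → Set (ℤ → Fin d) := fun m =>
    freeSet d ℓ 0 n ∩ {x | HasPeriodOn x m (n + 1 - 12 * m) (n + 1)}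
  have h1 : d * freeCount d ℓ n ≤ cnt (freeSet d ℓ 0 n) 0 (n + 1) := by
    have := mul_cnt_le_inter (S := freeSet d ℓ 0 n) (S' := Set.univ) (a := 0) (n := n) (k := 1)
      (by simpa using localOn_freeSet ℓ 0 n) (localOn_univ _ _)
    rw [Set.inter_univ] at this
    refine le_trans ?_ this
    rw [mul_comm]
    exact Nat.mul_le_mul_left _ (le_cnt_univ_one _)
  have h2 : freeSet d ℓ 0 n ⊆
      freeSet d ℓ 0 (n + 1 : ℕ) ∪ ⋃ m ∈ Finset.Icc 1 ((n + 1) / 12), Q m := by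
    intro x hx
    by_cases hx' : x ∈ freeSet d ℓ 0 (n + 1 : ℕ)
    · exact Or.inl hx'
    refine Or.inr ?_
    simp only [freeSet, Set.mem_ofPred_eq, FreeOn, not_forall, not_not] at hx'
    obtain ⟨m, hm, s, hs, ht, hp⟩ := hx'
    have hl := hℓ m hm
    push_cast at ht
    have hst : s + ℓ m = n + 1 := by
      by_contra hne
      exact hx m hm s hs (by omega) hp
    simp only [Set.mem_iUnion, Finset.mem_Icc]
    refine ⟨m, ⟨hm, by omega⟩, hx, ?_⟩
    exact hp.mono (by omega) (by omega)
  calc d * freeCount d ℓ n ≤ cnt (freeSet d ℓ 0 n) 0 (n + 1) := h1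
    _ ≤ _ := cnt_mono h2 _ _
    _ ≤ _ := cnt_union_le _ _ _ _
    _ ≤ freeCount d ℓ (n + 1) + ∑ m ∈ Finset.Icc 1 ((n + 1) / 12), cnt (Q m) 0 (n + 1) :=
      Nat.add_le_add_left (cnt_biUnion_le _ _ _ _) _
    _ ≤ _ := by
      refine Nat.add_le_add_left (Finset.sum_le_sum fun m hm => ?_) _
      rw [Finset.mem_Icc] at hm
      have hm12 : 12 * m ≤ n + 1 := by omega
      refine (cnt_le_of_determined (b := 0) (k := n + 1 - 11 * m) ?_).trans
        (cnt_mono (Set.inter_subset_left.trans (freeSet_anti le_rfl (by omega))) _ _)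
      intro x hx y hy e
      have e' := HasPeriodOn.eqOn_of_left (by omega) hx.2 hy.2
        (e.mono (Set.Ico_subset_Ico (by omega) (by omega)))
      intro i hi
      have h1 := hi.1
      have h2 := hi.2
      push_cast at h2
      by_cases h : i < (n : ℤ) + 1 - 12 * m
      · exact e ⟨by omega, by omega⟩
      · exact e' ⟨by omega, by omega⟩

theorem sum_Icc_pow_le {r : ℝ} (h0 : 0 ≤ r) (h1 : r < 1) (M : ℕ) :
    ∑ m ∈ Finset.Icc 1 M, r ^ m ≤ r / (1 - r) := by
  have h : ∑ m ∈ Finset.Icc 1 M, r ^ m ≤ r / (1 - r) - r / (1 - r) * r ^ M := by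
    have : 1 - r ≠ 0 := by linarith
    induction M with
    | zero => simp
    | succ M ih =>
      rw [Finset.sum_Icc_succ_top (by omega)]
      have : r / (1 - r) * r ^ M = r ^ (M + 1) + r / (1 - r) * r ^ (M + 1) := by
        field_simp
        ring
      linarith
  have : 0 ≤ r / (1 - r) * r ^ M := by
    have : 0 < 1 - r := by linarith
    positivity
  linarith

theorem freeCount_zero_pos (hd : 2 ≤ d) (hℓ : ∀ m, 0 < m → 12 * m ≤ ℓ m) :
    0 < freeCount d ℓ 0 := by
  refine cnt_pos ⟨fun _ => ⟨0, by omega⟩, fun m hm s hs ht => ?_⟩ _ _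
  have := hℓ m hm
  push_cast at ht
  omega

theorem pow_mul_le_of_step {f : ℕ → ℝ} {c : ℝ} (hc : 0 ≤ c) {n : ℕ}
    (h : ∀ k < n, c * f k ≤ f (k + 1)) (k j : ℕ) (hkj : k + j ≤ n) : c ^ j * f k ≤ f (k + j) := by
  induction j with
  | zero => simp
  | succ j ih =>
    calc c ^ (j + 1) * f k = c * (c ^ j * f k) := by ring
      _ ≤ c * f (k + j) := mul_le_mul_of_nonneg_left (ih (by omega)) hc
      _ ≤ f (k + (j + 1)) := h (k + j) (by omega)

/-- By induction, erasing `11 * m` letters after adding one costs a factor `c ^ (11 * m - 1) ≥ 9 ^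
m`, because `11 * m - 1 ≥ 10 * m` and `(7 / 4) ^ 10 ≥ 9`. The errors sum to at most `1 / 8 ≤ d / 8`,
which reproduces the rate `d - d / 8`. -/
theorem freeCount_succ (hd : 2 ≤ d) (hℓ : ∀ m, 0 < m → 12 * m ≤ ℓ m) (n : ℕ) :
    (7 * d / 8 : ℝ) * freeCount d ℓ n ≤ freeCount d ℓ (n + 1) := by
  have hd' : (2 : ℝ) ≤ d := by exact_mod_cast hd
  set c : ℝ := 7 * d / 8 with hcdef
  have hc : 7 / 4 ≤ c := by rw [hcdef]; linarith
  induction n using Nat.strong_induction_on with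
  | _ n ih =>
    have h1 := mul_freeCount_le (d := d) hℓ n
    have h2 : (d : ℝ) * freeCount d ℓ n ≤ freeCount d ℓ (n + 1) +
        ∑ m ∈ Finset.Icc 1 ((n + 1) / 12), (freeCount d ℓ (n + 1 - 11 * m) : ℝ) := by
      exact_mod_cast h1
    have h3 : ∑ m ∈ Finset.Icc 1 ((n + 1) / 12), (freeCount d ℓ (n + 1 - 11 * m) : ℝ) ≤
        ∑ m ∈ Finset.Icc 1 ((n + 1) / 12), (1 / 9 : ℝ) ^ m * freeCount d ℓ n := by
      refine Finset.sum_le_sum fun m hm => ?_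
      rw [Finset.mem_Icc] at hm
      have h4 := pow_mul_le_of_step (f := fun k => (freeCount d ℓ k : ℝ)) (by linarith) ih
        (n + 1 - 11 * m) (11 * m - 1) (by omega)
      rw [show n + 1 - 11 * m + (11 * m - 1) = n by omega] at h4
      have h5 : (9 : ℝ) ^ m ≤ c ^ (11 * m - 1) := by
        calc (9 : ℝ) ^ m ≤ (c ^ 10) ^ m := by
              refine pow_le_pow_left₀ (by norm_num) ?_ _
              calc (9 : ℝ) ≤ (7 / 4) ^ 10 := by norm_num
                _ ≤ c ^ 10 := pow_le_pow_left₀ (by norm_num) hc _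
          _ = c ^ (10 * m) := by rw [pow_mul]
          _ ≤ c ^ (11 * m - 1) := pow_le_pow_right₀ (by linarith) (by omega)
      have h6 : (9 : ℝ) ^ m * freeCount d ℓ (n + 1 - 11 * m) ≤ freeCount d ℓ n :=
        (mul_le_mul_of_nonneg_right h5 (Nat.cast_nonneg _)).trans h4
      rw [one_div, inv_pow, inv_mul_eq_div, le_div_iff₀ (by positivity)]
      linarith
    rw [← Finset.sum_mul] at h3
    have h7 := sum_Icc_pow_le (r := 1 / 9) (by norm_num) (by norm_num) ((n + 1) / 12)
    have h8 : (∑ m ∈ Finset.Icc 1 ((n + 1) / 12), (1 / 9 : ℝ) ^ m) * freeCount d ℓ n ≤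
        (d / 8) * freeCount d ℓ n :=
      mul_le_mul_of_nonneg_right (h7.trans (by norm_num; linarith)) (Nat.cast_nonneg _)
    have : c * freeCount d ℓ n = d * freeCount d ℓ n - d / 8 * freeCount d ℓ n := by
      rw [hcdef]; ring
    linarith

theorem pow_mul_freeCount_le (hd : 2 ≤ d) (hℓ : ∀ m, 0 < m → 12 * m ≤ ℓ m) (k j : ℕ) :
    (7 * d / 8 : ℝ) ^ j * freeCount d ℓ k ≤ freeCount d ℓ (k + j) :=
  pow_mul_le_of_step (f := fun k => (freeCount d ℓ k : ℝ)) (n := k + j) (by positivity)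
    (fun k _ => freeCount_succ hd hℓ k) k j le_rfl

theorem freeCount_pos (hd : 2 ≤ d) (hℓ : ∀ m, 0 < m → 12 * m ≤ ℓ m) (n : ℕ) :
    0 < freeCount d ℓ n := by
  have h := pow_mul_freeCount_le hd hℓ 0 n
  have h0 : (0 : ℝ) < freeCount d ℓ 0 := by exact_mod_cast freeCount_zero_pos hd hℓ
  have hd' : (2 : ℝ) ≤ d := by exact_mod_cast hd
  rw [zero_add] at h
  have : (0 : ℝ) < freeCount d ℓ n := lt_of_lt_of_le (by positivity) h
  exact_mod_cast this

/-- Stripping a fourth power from the front. -/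
theorem cnt_inter_prefix_period_le (S : Set (ℤ → Fin d)) (a : ℤ) {n m : ℕ} (hm : 0 < m)
    (hn : 4 * m ≤ n) :
    cnt (S ∩ {x | HasPeriodOn x m a (a + 4 * m)}) a n ≤
      d ^ m * cnt S (a + 4 * m) (n - 4 * m) := by
  refine (cnt_le_mul (b := a) (k := m) (c := a + 4 * m) (l := n - 4 * m) ?_).trans
    (Nat.mul_le_mul (cnt_le_pow _ _ _) (cnt_mono Set.inter_subset_left _ _))
  intro x hx y hy e1 e2 i hi
  have h1 := hi.1
  have h2 := hi.2
  by_cases h : i < a + 4 * m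
  · exact HasPeriodOn.eqOn_of_left hm hx.2 hy.2 e1 ⟨h1, h⟩
  · exact e2 ⟨by omega, by omega⟩

/-- Stripping a fourth power from the back. -/
theorem cnt_inter_suffix_period_le (S : Set (ℤ → Fin d)) (a b : ℤ) {n m : ℕ} (hm : 0 < m)
    (hn : 4 * m ≤ n) (hb : b = a + n) :
    cnt (S ∩ {x | HasPeriodOn x m (b - 4 * m) b}) a n ≤ d ^ m * cnt S a (n - 4 * m) := by
  subst hb
  refine (cnt_le_mul (b := a + n - m) (k := m) (c := a) (l := n - 4 * m) ?_).trans
    (Nat.mul_le_mul (cnt_le_pow _ _ _) (cnt_mono Set.inter_subset_left _ _))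
  intro x hx y hy e1 e2 i hi
  have h1 := hi.1
  have h2 := hi.2
  by_cases h : i < a + n - 4 * m
  · exact e2 ⟨by omega, by omega⟩
  · exact HasPeriodOn.eqOn_of_right hm hx.2 hy.2
      (e1.mono (Set.Ico_subset_Ico le_rfl (by omega))) ⟨by omega, h2⟩

/-- Every point of `S` is prefix-good or starts with a fourth power. -/
theorem cnt_le_prefixGood_add (S : Set (ℤ → Fin d)) (a : ℤ) (n : ℕ) :
    cnt S a n ≤ cnt (S ∩ {x | PrefixGoodOn x a (a + n)}) a n +
      ∑ m ∈ Finset.Icc 1 (n / 4), d ^ m * cnt S (a + 4 * m) (n - 4 * m) := by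
  have h2 : S ⊆ (S ∩ {x | PrefixGoodOn x a (a + n)}) ∪
      ⋃ m ∈ Finset.Icc 1 (n / 4), (S ∩ {x | HasPeriodOn x m a (a + 4 * m)}) := by
    intro x hx
    by_cases hx' : PrefixGoodOn x a (a + n)
    · exact Or.inl ⟨hx, hx'⟩
    refine Or.inr ?_
    simp only [PrefixGoodOn, not_forall, not_not] at hx'
    obtain ⟨m, hm, ht, hp⟩ := hx'
    simp only [Set.mem_iUnion, Finset.mem_Icc]
    exact ⟨m, ⟨hm, by omega⟩, hx, hp⟩
  refine (cnt_mono h2 _ _).trans ((cnt_union_le _ _ _ _).trans (Nat.add_le_add_left ?_ _))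
  refine (cnt_biUnion_le _ _ _ _).trans (Finset.sum_le_sum fun m hm => ?_)
  rw [Finset.mem_Icc] at hm
  exact cnt_inter_prefix_period_le S a (by omega) (by omega)

/-- Every point of `S` is suffix-good or ends with a fourth power. -/
theorem cnt_le_suffixGood_add (S : Set (ℤ → Fin d)) (a : ℤ) (n : ℕ) :
    cnt S a n ≤ cnt (S ∩ {x | SuffixGoodOn x a (a + n)}) a n +
      ∑ m ∈ Finset.Icc 1 (n / 4), d ^ m * cnt S a (n - 4 * m) := by
  have h2 : S ⊆ (S ∩ {x | SuffixGoodOn x a (a + n)}) ∪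
      ⋃ m ∈ Finset.Icc 1 (n / 4), (S ∩ {x | HasPeriodOn x m (a + n - 4 * m) (a + n)}) := by
    intro x hx
    by_cases hx' : SuffixGoodOn x a (a + n)
    · exact Or.inl ⟨hx, hx'⟩
    refine Or.inr ?_
    simp only [SuffixGoodOn, not_forall, not_not] at hx'
    obtain ⟨m, hm, ht, hp⟩ := hx'
    simp only [Set.mem_iUnion, Finset.mem_Icc]
    exact ⟨m, ⟨hm, by omega⟩, hx, hp⟩
  refine (cnt_mono h2 _ _).trans ((cnt_union_le _ _ _ _).trans (Nat.add_le_add_left ?_ _))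
  refine (cnt_biUnion_le _ _ _ _).trans (Finset.sum_le_sum fun m hm => ?_)
  rw [Finset.mem_Icc] at hm
  exact cnt_inter_suffix_period_le S a _ (by omega) (by omega) rfl

/-- A fourth power of period `m` has at most `d ^ m` forms, but removing it shortens the word by `4
* m`. This inequality makes the net cost of carrying one at most `(1 / 4) ^ m`. -/
theorem le_pow_four_of_le {c : ℝ} (hd : 2 ≤ d) (hc : (7 * d / 8 : ℝ) ≤ c) : 4 * d ≤ c ^ 4 := by
  have hd' : (2 : ℝ) ≤ d := by exact_mod_cast hd
  calc (4 * d : ℝ) ≤ (7 * d / 8 : ℝ) ^ 4 := by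
        have : (8 : ℝ) * d ≤ d ^ 4 := by
          have : (2 : ℝ) ^ 3 ≤ (d : ℝ) ^ 3 := pow_le_pow_left₀ (by norm_num) hd' _
          nlinarith
        rw [div_pow, mul_pow]
        linarith
    _ ≤ c ^ 4 := pow_le_pow_left₀ (by positivity) hc _

theorem pow_mul_freeCount_sub_le (hd : 2 ≤ d) (hℓ : ∀ m, 0 < m → 12 * m ≤ ℓ m) {n m : ℕ}
    (h : 4 * m ≤ n) :
    (d : ℝ) ^ m * freeCount d ℓ (n - 4 * m) ≤ (1 / 4) ^ m * freeCount d ℓ n := by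
  have h1 := pow_mul_freeCount_le hd hℓ (n - 4 * m) (4 * m)
  rw [show n - 4 * m + 4 * m = n by omega, pow_mul] at h1
  have h2 : (4 * d : ℝ) ^ m ≤ ((7 * d / 8 : ℝ) ^ 4) ^ m :=
    pow_le_pow_left₀ (by positivity) (le_pow_four_of_le hd le_rfl) _
  have h3 := (mul_le_mul_of_nonneg_right h2 (Nat.cast_nonneg (freeCount d ℓ (n - 4 * m)))).trans h1
  rw [mul_pow] at h3
  rw [one_div, inv_pow, inv_mul_eq_div, le_div_iff₀ (by positivity)]
  linarith

/-- Words starting with a fourth power make up a proportion of at most `∑ (1 / 4) ^ m ≤ 1 / 3`, and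
so do those ending with one. At least a third remain. -/
theorem freeCount_le_three_mul_goodCount (hd : 2 ≤ d) (hℓ : ∀ m, 0 < m → 12 * m ≤ ℓ m) (n : ℕ) :
    (freeCount d ℓ n : ℝ) ≤ 3 * goodCount d ℓ n := by
  have hsum : (∑ m ∈ Finset.Icc 1 (n / 4), (d : ℝ) ^ m * freeCount d ℓ (n - 4 * m)) ≤
      1 / 3 * freeCount d ℓ n := by
    calc _ ≤ ∑ m ∈ Finset.Icc 1 (n / 4), (1 / 4 : ℝ) ^ m * freeCount d ℓ n :=
          Finset.sum_le_sum fun m hm => pow_mul_freeCount_sub_le hd hℓ (by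
            rw [Finset.mem_Icc] at hm; omega)
      _ = (∑ m ∈ Finset.Icc 1 (n / 4), (1 / 4 : ℝ) ^ m) * freeCount d ℓ n := by
          rw [Finset.sum_mul]
      _ ≤ _ := mul_le_mul_of_nonneg_right
          ((sum_Icc_pow_le (by norm_num) (by norm_num) _).trans (by norm_num)) (Nat.cast_nonneg _)
  have h1 : freeCount d ℓ n ≤
      cnt (freeSet d ℓ 0 n ∩ {x | PrefixGoodOn x 0 n}) 0 n +
      ∑ m ∈ Finset.Icc 1 (n / 4), d ^ m * freeCount d ℓ (n - 4 * m) := by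
    have := cnt_le_prefixGood_add (freeSet d ℓ 0 n) 0 n
    simp only [zero_add] at this
    refine this.trans (Nat.add_le_add_left (Finset.sum_le_sum fun m hm => ?_) _)
    rw [Finset.mem_Icc] at hm
    refine Nat.mul_le_mul_left _ ?_
    rw [← cnt_freeSet (4 * m : ℤ)]
    exact cnt_mono (freeSet_anti (by omega) (by omega)) _ _
  have h2 : cnt (freeSet d ℓ 0 n ∩ {x | PrefixGoodOn x 0 n}) 0 n ≤ goodCount d ℓ n +
      ∑ m ∈ Finset.Icc 1 (n / 4), d ^ m * freeCount d ℓ (n - 4 * m) := by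
    have := cnt_le_suffixGood_add (freeSet d ℓ 0 n ∩ {x | PrefixGoodOn x 0 n}) 0 n
    simp only [zero_add, Set.inter_assoc] at this
    refine this.trans (Nat.add_le_add_left (Finset.sum_le_sum fun m hm => ?_) _)
    rw [Finset.mem_Icc] at hm
    refine Nat.mul_le_mul_left _ (cnt_mono (Set.inter_subset_left.trans ?_) _ _)
    exact freeSet_anti (by omega) (by omega)
  have h3 : (freeCount d ℓ n : ℝ) ≤
      goodCount d ℓ n + (∑ m ∈ Finset.Icc 1 (n / 4), (d : ℝ) ^ m * freeCount d ℓ (n - 4 * m)) +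
      (∑ m ∈ Finset.Icc 1 (n / 4), (d : ℝ) ^ m * freeCount d ℓ (n - 4 * m)) := by
    exact_mod_cast h1.trans (Nat.add_le_add_right h2 _)
  linarith

/-- Good free words can be concatenated. -/
theorem freeOn_of_two (hℓ : ∀ m, 0 < m → 12 * m ≤ ℓ m) {x : ℤ → Fin d} {a b c : ℤ}
    (h1 : FreeOn ℓ x a b) (h2 : FreeOn ℓ x b c) (g1 : SuffixGoodOn x a b)
    (g2 : PrefixGoodOn x b c) : FreeOn ℓ x a c := by
  intro m hm s hs ht hp
  have hl := hℓ m hm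
  by_cases c1 : s + ℓ m ≤ b
  · exact h1 m hm s hs c1 hp
  by_cases c2 : b ≤ s
  · exact h2 m hm s c2 ht hp
  -- The power straddles `b`: at least `4 * m` of its letters lie before `b`, or else more than `8 *
  -- m` lie from `b` on.
  by_cases c3 : s ≤ b - 4 * m
  · exact g1 m hm (by omega) (hp.mono (by omega) (by omega))
  · exact g2 m hm (by omega) (hp.mono (by omega) (by omega))

theorem goodCount_mul_le (hℓ : ∀ m, 0 < m → 12 * m ≤ ℓ m) (n k : ℕ) :
    goodCount d ℓ n * goodCount d ℓ k ≤ freeCount d ℓ (n + k) := by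
  have h := mul_cnt_le_inter (S := freeSet d ℓ 0 (0 + n) ∩ goodSet d 0 (0 + n))
    (S' := freeSet d ℓ (0 + n) (0 + n + k) ∩ goodSet d (0 + n) (0 + n + k)) (a := 0)
    (n := n) (k := k) ((localOn_freeSet _ _ _).inter (localOn_goodSet _ _))
    ((localOn_freeSet _ _ _).inter (localOn_goodSet _ _))
  rw [cnt_freeSet_inter_goodSet, cnt_freeSet_inter_goodSet] at h
  refine h.trans (cnt_mono ?_ _ _)
  rintro x ⟨⟨f1, g1⟩, ⟨f2, g2⟩⟩
  have := freeOn_of_two hℓ f1 f2 g1.2 g2.1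
  simpa [freeSet] using this

theorem freeCount_mul_le (hd : 2 ≤ d) (hℓ : ∀ m, 0 < m → 12 * m ≤ ℓ m) (n k : ℕ) :
    (freeCount d ℓ n : ℝ) * freeCount d ℓ k ≤ 9 * freeCount d ℓ (n + k) := by
  have h1 := freeCount_le_three_mul_goodCount hd hℓ n
  have h2 := freeCount_le_three_mul_goodCount hd hℓ k
  have h3 : (goodCount d ℓ n : ℝ) * goodCount d ℓ k ≤ freeCount d ℓ (n + k) := by
    exact_mod_cast goodCount_mul_le hℓ n k
  calc _ ≤ (3 * goodCount d ℓ n : ℝ) * (3 * goodCount d ℓ k) :=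
        mul_le_mul h1 h2 (Nat.cast_nonneg _) (by positivity)
    _ = 9 * ((goodCount d ℓ n : ℝ) * goodCount d ℓ k) := by ring
    _ ≤ _ := by linarith

/-- The number of free words grows exactly exponentially, up to a constant factor. -/
theorem exists_growth_rate (hd : 2 ≤ d) (hℓ : ∀ m, 0 < m → 12 * m ≤ ℓ m) :
    ∃ κ : ℝ, (7 * d / 8 : ℝ) ≤ κ ∧
      ∀ n, κ ^ n ≤ freeCount d ℓ n ∧ (freeCount d ℓ n : ℝ) ≤ 9 * κ ^ n := by
  have hd' : (2 : ℝ) ≤ d := by exact_mod_cast hd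
  have hpos : ∀ n, (0 : ℝ) < freeCount d ℓ n := fun n => by exact_mod_cast freeCount_pos hd hℓ n
  let u : ℕ → ℝ := fun n => Real.log (freeCount d ℓ n)
  -- Near-supermultiplicativity makes `v` subadditive as well. The averages of `u` and `v` have
  -- opposite limits, so the two Fekete lower bounds enclose `u n` between `n * hu.lim` and `n *
  -- hu.lim + log 9`.
  let v : ℕ → ℝ := fun n => Real.log 9 - Real.log (freeCount d ℓ n)
  have hu : Subadditive u := by
    intro m n
    simp only [u]
    rw [← Real.log_mul (hpos m).ne' (hpos n).ne']
    exact Real.log_le_log (hpos _) (by exact_mod_cast freeCount_add_le m n)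
  have hv : Subadditive v := by
    intro m n
    have : Real.log (freeCount d ℓ m * freeCount d ℓ n) ≤ Real.log (9 * freeCount d ℓ (m + n)) :=
      Real.log_le_log (mul_pos (hpos m) (hpos n)) (freeCount_mul_le hd hℓ m n)
    rw [Real.log_mul (hpos m).ne' (hpos n).ne', Real.log_mul (by norm_num) (hpos _).ne'] at this
    simp only [v]
    linarith
  have hlog : ∀ n, 0 ≤ u n := fun n =>
    Real.log_nonneg (by exact_mod_cast freeCount_pos hd hℓ n)
  have hub : BddBelow (Set.range fun n => u n / n) :=
    ⟨0, by rintro _ ⟨n, rfl⟩; exact div_nonneg (hlog n) (Nat.cast_nonneg _)⟩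
  have hup : ∀ n, u n ≤ n * Real.log d := fun n => by
    have : (freeCount d ℓ n : ℝ) ≤ (d : ℝ) ^ n := by exact_mod_cast cnt_le_pow _ _ _
    calc u n ≤ Real.log ((d : ℝ) ^ n) := Real.log_le_log (hpos n) this
      _ = _ := Real.log_pow _ _
  have hlogd : 0 ≤ Real.log d := Real.log_nonneg (by linarith)
  have hvb : BddBelow (Set.range fun n => v n / n) := by
    refine ⟨-Real.log d, ?_⟩
    rintro _ ⟨n, rfl⟩
    rcases Nat.eq_zero_or_pos n with rfl | hn
    · simpa using hlogd
    · have hn' : (0 : ℝ) < n := by exact_mod_cast hn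
      rw [le_div_iff₀ hn']
      have h9 : 0 ≤ Real.log 9 := Real.log_nonneg (by norm_num)
      have := hup n
      simp only [v, u] at *
      linarith
  have hlim : hv.lim = -hu.lim := by
    have t1 := hu.tendsto_lim hub
    have t2 := hv.tendsto_lim hvb
    have t3 : Tendsto (fun n : ℕ => Real.log 9 / (n : ℝ)) atTop (nhds 0) :=
      tendsto_const_div_atTop_nhds_zero_nat _
    have t4 := t3.sub t1
    rw [zero_sub] at t4
    refine tendsto_nhds_unique t2 (t4.congr fun n => ?_)
    simp only [v, u]
    ring
  have lower : ∀ n : ℕ, n * hu.lim ≤ u n := fun n => by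
    rcases Nat.eq_zero_or_pos n with rfl | hn
    · simpa using hlog 0
    · have := hu.lim_le_div hub hn.ne'
      rw [le_div_iff₀ (by exact_mod_cast hn)] at this
      linarith
  have upper : ∀ n : ℕ, u n ≤ n * hu.lim + Real.log 9 := fun n => by
    rcases Nat.eq_zero_or_pos n with rfl | hn
    · have h0 := hup 0
      have h9 : 0 ≤ Real.log 9 := Real.log_nonneg (by norm_num)
      simp only [Nat.cast_zero, zero_mul, zero_add] at h0 ⊢
      linarith
    · have := hv.lim_le_div hvb hn.ne'
      rw [le_div_iff₀ (by exact_mod_cast hn), hlim] at this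
      simp only [u, v] at *
      linarith
  refine ⟨Real.exp hu.lim, ?_, fun n => ⟨?_, ?_⟩⟩
  · have hl : Real.log (7 * d / 8) ≤ hu.lim := by
      refine ge_of_tendsto (hu.tendsto_lim hub) ?_
      filter_upwards [eventually_gt_atTop 0] with n hn
      rw [le_div_iff₀ (by exact_mod_cast hn)]
      have h1 := pow_mul_freeCount_le hd hℓ 0 n
      rw [zero_add] at h1
      have h0 : (1 : ℝ) ≤ freeCount d ℓ 0 := by exact_mod_cast freeCount_zero_pos hd hℓ
      have h2 : (7 * d / 8 : ℝ) ^ n ≤ freeCount d ℓ n :=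
        (le_mul_of_one_le_right (by positivity) h0).trans h1
      have h3 := Real.log_le_log (by positivity) h2
      rw [Real.log_pow] at h3
      linarith
    have := Real.exp_le_exp.2 hl
    rwa [Real.exp_log (by positivity)] at this
  · rw [← Real.exp_nat_mul, ← Real.le_log_iff_exp_le (hpos n)]
    exact lower n
  · have := Real.exp_le_exp.2 (upper n)
    rw [Real.exp_add, Real.exp_log (by norm_num : (0 : ℝ) < 9), Real.exp_log (hpos n)] at this
    rw [← Real.exp_nat_mul]
    linarith

end Growth

/-! ### Concatenating five good words -/

section Joining

variable {d : ℕ} {ℓ : ℕ → ℕ}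

/-- A power meets a good free window in fewer than four periods. -/
theorem overlap_lt (hℓ : ∀ m, 0 < m → 12 * m ≤ ℓ m) {x : ℤ → Fin d} {a b s : ℤ} {m : ℕ}
    (hm : 0 < m) (hf : x ∈ freeSet d ℓ a b ∩ goodSet d a b)
    (hp : HasPeriodOn x m s (s + ℓ m)) : min b (s + ℓ m) < max a s + 4 * m := by
  have hl := hℓ m hm
  by_contra! hcon
  by_cases h1 : s ≤ a
  · exact hf.2.1 m hm (by omega) (hp.mono h1 (by omega))
  · by_cases h2 : s + ℓ m ≤ b
    · exact hf.1 m hm s (by omega) h2 hp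
    · exact hf.2.2 m hm (by omega) (hp.mono (by omega) (by omega))

/-- A power in a concatenation of five good free words covers the middle word together with a
full period next to it. -/
theorem freeOn_of_five (hℓ : ∀ m, 0 < m → 12 * m ≤ ℓ m) {x : ℤ → Fin d} {p₀ p₁ p₂ p₃ p₄ p₅ : ℤ}
    (o₂ : p₁ ≤ p₂) (o₃ : p₂ ≤ p₃) (o₄ : p₃ ≤ p₄) (o₅ : p₄ ≤ p₅)
    (h₁ : x ∈ freeSet d ℓ p₀ p₁ ∩ goodSet d p₀ p₁) (h₂ : x ∈ freeSet d ℓ p₁ p₂ ∩ goodSet d p₁ p₂)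
    (h₃ : x ∈ freeSet d ℓ p₂ p₃ ∩ goodSet d p₂ p₃) (h₄ : x ∈ freeSet d ℓ p₃ p₄ ∩ goodSet d p₃ p₄)
    (h₅ : x ∈ freeSet d ℓ p₄ p₅ ∩ goodSet d p₄ p₅)
    (hL : ∀ m : ℕ, 0 < m → 4 * m < p₄ - p₁ → p₀ ≤ p₂ - m → ¬ HasPeriodOn x m (p₂ - m) p₃)
    (hR : ∀ m : ℕ, 0 < m → 4 * m < p₄ - p₁ → p₃ + m ≤ p₅ → ¬ HasPeriodOn x m p₂ (p₃ + m)) :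
    x ∈ freeSet d ℓ p₀ p₅ := by
  intro m hm s hs ht hp
  have hl := hℓ m hm
  have e₁ := overlap_lt hℓ hm h₁ hp
  have e₂ := overlap_lt hℓ hm h₂ hp
  have e₃ := overlap_lt hℓ hm h₃ hp
  have e₄ := overlap_lt hℓ hm h₄ hp
  have e₅ := overlap_lt hℓ hm h₅ hp
  -- Three consecutive windows hold fewer than `12 * m` letters of the power, so it cannot fit in
  -- the last three or in the first three. The two outermost windows hold fewer than `8 * m`, which
  -- leaves more than `4 * m` between `p₁` and `p₄`.
  have k1 : s ≤ p₂ := by omega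
  have k2 : p₃ ≤ s + ℓ m := by omega
  have k3 : 4 * m < p₄ - p₁ := by omega
  -- A power starting less than a period before `p₂` runs more than a period past `p₃`, since the
  -- middle window holds fewer than `4 * m` of its letters.
  by_cases c : s ≤ p₂ - m
  · exact hL m hm k3 (by omega) (hp.mono c k2)
  · exact hR m hm k3 (by omega) (hp.mono k1 (by omega))

theorem mul_cnt_le_inter_of_eq {S S' : Set (ℤ → Fin d)} {a c e : ℤ} {n k : ℕ} (hc : c = a + n)
    (he : e = c + k) (h : LocalOn S a c) (hS : LocalOn S' c e) :
    cnt S a n * cnt S' c k ≤ cnt (S ∩ S') a (n + k) := by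
  subst hc he
  exact mul_cnt_le_inter h hS

/-- Counting the free words among concatenations of five good free words. -/
theorem five_mul_cnt_le (hℓ : ∀ m, 0 < m → 12 * m ≤ ℓ m) {p₀ p₁ p₂ p₃ p₄ p₅ : ℤ}
    {n₁ n₂ n₃ n₄ n₅ : ℕ} (o₁ : p₁ = p₀ + n₁) (o₂ : p₂ = p₁ + n₂) (o₃ : p₃ = p₂ + n₃)
    (o₄ : p₄ = p₃ + n₄) (o₅ : p₅ = p₄ + n₅) {S₁ S₂ S₃ S₄ S₅ : Set (ℤ → Fin d)}
    (l₁ : LocalOn S₁ p₀ p₁) (l₂ : LocalOn S₂ p₁ p₂) (l₃ : LocalOn S₃ p₂ p₃)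
    (l₄ : LocalOn S₄ p₃ p₄) (l₅ : LocalOn S₅ p₄ p₅)
    (h₁ : S₁ ⊆ freeSet d ℓ p₀ p₁ ∩ goodSet d p₀ p₁)
    (h₂ : S₂ ⊆ freeSet d ℓ p₁ p₂ ∩ goodSet d p₁ p₂)
    (h₃ : S₃ ⊆ freeSet d ℓ p₂ p₃ ∩ goodSet d p₂ p₃)
    (h₄ : S₄ ⊆ freeSet d ℓ p₃ p₄ ∩ goodSet d p₃ p₄)
    (h₅ : S₅ ⊆ freeSet d ℓ p₄ p₅ ∩ goodSet d p₄ p₅) :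
    cnt S₁ p₀ n₁ * cnt S₂ p₁ n₂ * cnt S₃ p₂ n₃ * cnt S₄ p₃ n₄ * cnt S₅ p₄ n₅ ≤
      cnt (S₂ ∩ S₄ ∩ freeSet d ℓ p₀ p₅) p₀ (n₁ + n₂ + n₃ + n₄ + n₅) +
      2 * (n₂ + n₃ + n₄) *
        (cnt S₁ p₀ n₁ * cnt S₂ p₁ n₂ * (cnt S₄ p₃ n₄ * cnt S₅ p₄ n₅)) := by
  set N := n₁ + n₂ + n₃ + n₄ + n₅ with hN
  let J : Set (ℤ → Fin d) := S₁ ∩ S₂ ∩ S₃ ∩ S₄ ∩ S₅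
  -- Only periods with `4 * m < p₄ - p₁` can occur. With two sides to consider, this gives the
  -- factor `2 * (n₂ + n₃ + n₄)`.
  let R := Finset.Icc 1 (n₂ + n₃ + n₄)
  let QL : ℕ → Set (ℤ → Fin d) := fun m => J ∩ {x | p₀ ≤ p₂ - m ∧ HasPeriodOn x m (p₂ - m) p₃}
  let QR : ℕ → Set (ℤ → Fin d) := fun m => J ∩ {x | p₃ + m ≤ p₅ ∧ HasPeriodOn x m p₂ (p₃ + m)}
  have hprod : cnt S₁ p₀ n₁ * cnt S₂ p₁ n₂ * cnt S₃ p₂ n₃ * cnt S₄ p₃ n₄ * cnt S₅ p₄ n₅ ≤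
      cnt J p₀ N := by
    have m₁ : LocalOn (S₁ ∩ S₂) p₀ p₂ :=
      (l₁.mono le_rfl (by omega)).inter (l₂.mono (by omega) le_rfl)
    have m₂ : LocalOn (S₁ ∩ S₂ ∩ S₃) p₀ p₃ :=
      (m₁.mono le_rfl (by omega)).inter (l₃.mono (by omega) le_rfl)
    have m₃ : LocalOn (S₁ ∩ S₂ ∩ S₃ ∩ S₄) p₀ p₄ :=
      (m₂.mono le_rfl (by omega)).inter (l₄.mono (by omega) le_rfl)
    have q₁ := mul_cnt_le_inter_of_eq o₁ o₂ l₁ l₂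
    have q₂ := mul_cnt_le_inter_of_eq (n := n₁ + n₂) (by push_cast; omega) o₃ m₁ l₃
    have q₃ := mul_cnt_le_inter_of_eq (n := n₁ + n₂ + n₃) (by push_cast; omega) o₄ m₂ l₄
    have q₄ := mul_cnt_le_inter_of_eq (n := n₁ + n₂ + n₃ + n₄) (by push_cast; omega) o₅ m₃ l₅
    refine le_trans (Nat.mul_le_mul_right _ (le_trans (Nat.mul_le_mul_right _
      (le_trans (Nat.mul_le_mul_right _ q₁) q₂)) q₃)) q₄
  have hcov : J ⊆ (S₂ ∩ S₄ ∩ freeSet d ℓ p₀ p₅) ∪ ((⋃ m ∈ R, QL m) ∪ ⋃ m ∈ R, QR m) := by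
    intro x hx
    by_cases hfree : x ∈ freeSet d ℓ p₀ p₅
    · exact Or.inl ⟨⟨hx.1.1.1.2, hx.1.2⟩, hfree⟩
    refine Or.inr ?_
    by_contra hcon
    simp only [Set.mem_union, Set.mem_iUnion, not_or, not_exists] at hcon
    refine hfree (freeOn_of_five hℓ (p₁ := p₁) (p₂ := p₂) (p₃ := p₃) (p₄ := p₄)
      (by omega) (by omega) (by omega) (by omega) (h₁ hx.1.1.1.1) (h₂ hx.1.1.1.2) (h₃ hx.1.1.2)
      (h₄ hx.1.2) (h₅ hx.2) ?_ ?_)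
    · intro m hm hlt hle hp
      exact hcon.1 m (Finset.mem_Icc.2 ⟨hm, by omega⟩) ⟨hx, hle, hp⟩
    · intro m hm hlt hle hp
      exact hcon.2 m (Finset.mem_Icc.2 ⟨hm, by omega⟩) ⟨hx, hle, hp⟩
  have houter : cnt J p₀ (n₁ + n₂) * cnt J p₃ (n₄ + n₅) ≤
      cnt S₁ p₀ n₁ * cnt S₂ p₁ n₂ * (cnt S₄ p₃ n₄ * cnt S₅ p₄ n₅) := by
    refine Nat.mul_le_mul ((cnt_add_le _ _ _ _).trans (Nat.mul_le_mul ?_ ?_))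
      ((cnt_add_le _ _ _ _).trans (Nat.mul_le_mul ?_ ?_))
    · exact cnt_mono (fun x hx => hx.1.1.1.1) _ _
    · rw [← o₁]; exact cnt_mono (fun x hx => hx.1.1.1.2) _ _
    · exact cnt_mono (fun x hx => hx.1.2) _ _
    · rw [← o₄]; exact cnt_mono (fun x hx => hx.2) _ _
  -- The first period of `[p₂ - m, p₃)` lies to the left of the middle word and determines it, so
  -- the middle word contributes no factor. `hQR` is the mirror image.
  have hQL : ∀ m ∈ R, cnt (QL m) p₀ N ≤ cnt J p₀ (n₁ + n₂) * cnt J p₃ (n₄ + n₅) := by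
    intro m hm
    rw [Finset.mem_Icc] at hm
    refine (cnt_le_mul (b := p₀) (k := n₁ + n₂) (c := p₃) (l := n₄ + n₅) ?_).trans
      (Nat.mul_le_mul (cnt_mono Set.inter_subset_left _ _) (cnt_mono Set.inter_subset_left _ _))
    rintro x ⟨-, hx, hpx⟩ y ⟨-, -, hpy⟩ e1 e2 i hi
    have i1 := hi.1
    have i2 := hi.2
    have e3 := HasPeriodOn.eqOn_of_left (by omega) hpx hpy
      (e1.mono (Set.Ico_subset_Ico (by omega) (by push_cast; omega)))
    by_cases c1 : i < p₂
    · exact e1 ⟨i1, by push_cast; omega⟩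
    by_cases c2 : i < p₃
    · exact e3 ⟨by omega, c2⟩
    · exact e2 ⟨by omega, by push_cast; omega⟩
  have hQR : ∀ m ∈ R, cnt (QR m) p₀ N ≤ cnt J p₀ (n₁ + n₂) * cnt J p₃ (n₄ + n₅) := by
    intro m hm
    rw [Finset.mem_Icc] at hm
    refine (cnt_le_mul (b := p₀) (k := n₁ + n₂) (c := p₃) (l := n₄ + n₅) ?_).trans
      (Nat.mul_le_mul (cnt_mono Set.inter_subset_left _ _) (cnt_mono Set.inter_subset_left _ _))
    rintro x ⟨-, hx, hpx⟩ y ⟨-, -, hpy⟩ e1 e2 i hi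
    have i1 := hi.1
    have i2 := hi.2
    have e3 := HasPeriodOn.eqOn_of_right (by omega) hpx hpy
      (e2.mono (Set.Ico_subset_Ico (by omega) (by push_cast; omega)))
    by_cases c1 : i < p₂
    · exact e1 ⟨i1, by push_cast; omega⟩
    by_cases c2 : i < p₃
    · exact e3 ⟨by omega, by omega⟩
    · exact e2 ⟨by omega, by push_cast; omega⟩
  have hsum : ∀ Q : ℕ → Set (ℤ → Fin d),
      (∀ m ∈ R, cnt (Q m) p₀ N ≤ cnt J p₀ (n₁ + n₂) * cnt J p₃ (n₄ + n₅)) →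
      cnt (⋃ m ∈ R, Q m) p₀ N ≤ (n₂ + n₃ + n₄) *
        (cnt S₁ p₀ n₁ * cnt S₂ p₁ n₂ * (cnt S₄ p₃ n₄ * cnt S₅ p₄ n₅)) := by
    intro Q hQ
    refine (cnt_biUnion_le _ _ _ _).trans ((Finset.sum_le_card_nsmul _ _ _ hQ).trans ?_)
    simp only [R, Nat.card_Icc, Nat.add_sub_cancel, smul_eq_mul]
    exact Nat.mul_le_mul_left _ houter
  refine hprod.trans ((cnt_mono hcov _ _).trans ((cnt_union_le _ _ _ _).trans
    (Nat.add_le_add_left ((cnt_union_le _ _ _ _).trans ?_) _)))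
  have := hsum QL hQL
  have := hsum QR hQR
  rw [two_mul, add_mul]
  omega

end Joining

/-! ### Reducing free words to good words by stripping fourth powers -/

section Cores

variable {d : ℕ} {ℓ : ℕ → ℕ}

/-- Solving the renewal inequality that arises from stripping fourth powers. -/
theorem renewal_bound {τ : ℕ → ℝ} {P : ℝ} (s : ℕ)
    (h : ∀ i ≤ s, τ i ≤ P + ∑ m ∈ Finset.Icc 1 i, (1 / 4 : ℝ) ^ m * τ (i - m) +
      12 * (1 / 4) ^ i) (hP : 0 ≤ P) :
    ∀ i ≤ s, τ i ≤ 2 * P + 12 * (1 / 2) ^ i := by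
  intro i
  induction i using Nat.strong_induction_on with
  | _ i ih =>
    intro his
    have h1 : ∑ m ∈ Finset.Icc 1 i, (1 / 4 : ℝ) ^ m * τ (i - m) ≤
        ∑ m ∈ Finset.Icc 1 i, ((1 / 4 : ℝ) ^ m * (2 * P) + (12 * (1 / 2) ^ i) * (1 / 2) ^ m) := by
      refine Finset.sum_le_sum fun m hm => ?_
      rw [Finset.mem_Icc] at hm
      have := ih (i - m) (by omega) (by omega)
      have h2 : (1 / 4 : ℝ) ^ m * (1 / 2) ^ (i - m) = (1 / 2) ^ i * (1 / 2) ^ m := by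
        rw [show (1 / 4 : ℝ) = 1 / 2 * (1 / 2) by norm_num, mul_pow, mul_assoc, ← pow_add,
          show m + (i - m) = i by omega]
        ring
      calc (1 / 4 : ℝ) ^ m * τ (i - m) ≤ (1 / 4 : ℝ) ^ m * (2 * P + 12 * (1 / 2) ^ (i - m)) :=
            mul_le_mul_of_nonneg_left this (by positivity)
        _ = (1 / 4 : ℝ) ^ m * (2 * P) + 12 * ((1 / 4 : ℝ) ^ m * (1 / 2) ^ (i - m)) := by ring
        _ = _ := by rw [h2]; ring
    rw [Finset.sum_add_distrib, ← Finset.sum_mul, ← Finset.mul_sum] at h1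
    -- The coefficient of `P` is at most `1 + 2 / 3 ≤ 2`. The error terms close exactly: `(1 / 2) ^
    -- i * (1 - (1 / 2) ^ i) + (1 / 4) ^ i = (1 / 2) ^ i`.
    have h3 : ∑ m ∈ Finset.Icc 1 i, (1 / 4 : ℝ) ^ m ≤ 1 / 3 :=
      (sum_Icc_pow_le (by norm_num) (by norm_num) _).trans (by norm_num)
    have h4 : ∑ m ∈ Finset.Icc 1 i, (1 / 2 : ℝ) ^ m = 1 - (1 / 2) ^ i := by
      clear ih his h1 h3
      induction i with
      | zero => simp
      | succ i ih => rw [Finset.sum_Icc_succ_top (by omega), ih]; ring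
    have h5 : (1 / 4 : ℝ) ^ i = (1 / 2) ^ i * (1 / 2) ^ i := by
      rw [← mul_pow]; norm_num
    have h6 := h i his
    rw [h4] at h1
    rw [h5] at h6
    nlinarith

theorem sum_Ioc_quarter_pow_le {i M : ℕ} (h : i ≤ M) :
    ∑ m ∈ Finset.Ioc i M, (1 / 4 : ℝ) ^ m ≤ (1 / 4) ^ i := by
  have key : ∑ m ∈ Finset.Ioc i M, (1 / 4 : ℝ) ^ m ≤ 1 / 3 * ((1 / 4) ^ i - (1 / 4) ^ M) := by
    induction M, h using Nat.le_induction with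
    | base => simp
    | succ M hM ih =>
      rw [Finset.sum_Ioc_succ_top (by omega), pow_succ]
      linarith
  have h1 : (0 : ℝ) ≤ (1 / 4) ^ i := by positivity
  have h2 : (0 : ℝ) ≤ (1 / 4) ^ M := by positivity
  linarith

/-- Counts that can be reduced by stripping fourth powers are controlled by the irreducible
counts. -/
theorem strip_bound {κ : ℝ} (hκ0 : 0 < κ) (hκ : 4 * d ≤ κ ^ 4) {T p : ℕ → ℝ} {c : ℕ → ℕ → ℝ}
    {P : ℝ} (hP : 0 ≤ P) (hT : ∀ i, 0 ≤ T i) (n₀ s : ℕ)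
    (h : ∀ i ≤ s, T i ≤ p i + ∑ m ∈ Finset.Icc 1 ((n₀ + 4 * i) / 4), (d : ℝ) ^ m * c i m)
    (hc1 : ∀ i ≤ s, ∀ m ≤ i, c i m ≤ T (i - m))
    (hc2 : ∀ i ≤ s, ∀ m, i < m → 4 * m ≤ n₀ + 4 * i → c i m ≤ 9 * κ ^ (n₀ + 4 * i - 4 * m))
    (hp : ∀ i ≤ s, p i ≤ P * κ ^ (n₀ + 4 * i)) :
    T s ≤ (2 * P + 12 * (1 / 2) ^ s) * κ ^ (n₀ + 4 * s) := by
  have hstep : ∀ n m : ℕ, 4 * m ≤ n → (d : ℝ) ^ m * κ ^ (n - 4 * m) ≤ (1 / 4) ^ m * κ ^ n := by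
    intro n m hnm
    have h1 : (4 * d : ℝ) ^ m ≤ (κ ^ 4) ^ m := pow_le_pow_left₀ (by positivity) hκ _
    have h2 : κ ^ n = (κ ^ 4) ^ m * κ ^ (n - 4 * m) := by
      rw [← pow_mul, ← pow_add]
      congr 1
      omega
    rw [h2, ← mul_assoc]
    refine mul_le_mul_of_nonneg_right ?_ (by positivity)
    rw [mul_pow] at h1
    rw [one_div, inv_pow, inv_mul_eq_div, le_div_iff₀ (by positivity)]
    linarith
  have main := renewal_bound (τ := fun i => T i / κ ^ (n₀ + 4 * i)) (P := P) s ?_ hP s le_rfl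
  · rwa [div_le_iff₀ (by positivity)] at main
  intro i hi
  rw [div_le_iff₀ (by positivity)]
  have hb : ∑ m ∈ Finset.Icc 1 ((n₀ + 4 * i) / 4), (d : ℝ) ^ m * c i m ≤
      (∑ m ∈ Finset.Icc 1 i, (1 / 4 : ℝ) ^ m * (T (i - m) / κ ^ (n₀ + 4 * (i - m))) +
        9 * (1 / 4) ^ i) * κ ^ (n₀ + 4 * i) := by
    -- Stripping with `m ≤ i` leaves a window of the same family. With `m > i` fewer than `n₀`
    -- letters remain; the crude bound `9 * κ ^ n` then suffices, since these terms carry total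
    -- weight at most `(1 / 4) ^ i`.
    have hIcc : ∀ M, Finset.Icc 1 M = Finset.Ioc 0 M := fun M => by ext; simp [Nat.succ_le_iff]
    rw [hIcc, hIcc, ← Finset.sum_Ioc_consecutive _ (Nat.zero_le i) (by omega), add_mul]
    refine add_le_add ?_ ?_
    · rw [Finset.sum_mul]
      refine Finset.sum_le_sum fun m hm => ?_
      rw [Finset.mem_Ioc] at hm
      have h1 := hstep (n₀ + 4 * i) m (by omega)
      rw [show n₀ + 4 * i - 4 * m = n₀ + 4 * (i - m) by omega] at h1
      have hpos : 0 < κ ^ (n₀ + 4 * (i - m)) := by positivity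
      have hT0 := hT (i - m)
      calc (d : ℝ) ^ m * c i m ≤ (d : ℝ) ^ m * T (i - m) :=
            mul_le_mul_of_nonneg_left (hc1 i hi m hm.2) (by positivity)
        _ = ((d : ℝ) ^ m * κ ^ (n₀ + 4 * (i - m))) * (T (i - m) / κ ^ (n₀ + 4 * (i - m))) := by
            field_simp
        _ ≤ ((1 / 4) ^ m * κ ^ (n₀ + 4 * i)) * (T (i - m) / κ ^ (n₀ + 4 * (i - m))) :=
            mul_le_mul_of_nonneg_right h1 (by positivity)
        _ = _ := by ring
    · calc ∑ m ∈ Finset.Ioc i ((n₀ + 4 * i) / 4), (d : ℝ) ^ m * c i m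
          ≤ ∑ m ∈ Finset.Ioc i ((n₀ + 4 * i) / 4), (1 / 4 : ℝ) ^ m * (9 * κ ^ (n₀ + 4 * i)) := by
            refine Finset.sum_le_sum fun m hm => ?_
            rw [Finset.mem_Ioc] at hm
            have h1 := hstep (n₀ + 4 * i) m (by omega)
            have h2 := mul_le_mul_of_nonneg_left (hc2 i hi m hm.1 (by omega))
              (by positivity : (0 : ℝ) ≤ (d : ℝ) ^ m)
            linarith
        _ = (∑ m ∈ Finset.Ioc i ((n₀ + 4 * i) / 4), (1 / 4 : ℝ) ^ m) *
              (9 * κ ^ (n₀ + 4 * i)) := by rw [Finset.sum_mul]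
        _ ≤ (1 / 4) ^ i * (9 * κ ^ (n₀ + 4 * i)) :=
            mul_le_mul_of_nonneg_right (sum_Ioc_quarter_pow_le (by omega)) (by positivity)
        _ = _ := by ring
  have h1 := h i hi
  have h2 := hp i hi
  have h3 : 9 * (1 / 4 : ℝ) ^ i * κ ^ (n₀ + 4 * i) ≤ 12 * (1 / 4 : ℝ) ^ i * κ ^ (n₀ + 4 * i) := by
    have : 0 ≤ (1 / 4 : ℝ) ^ i * κ ^ (n₀ + 4 * i) := by positivity
    linarith
  linarith

/-- The words in a window around a local set are controlled by the good words in the slightly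
smaller windows. -/
theorem cnt_le_of_goodCores {κ : ℝ} (hκ0 : 0 < κ) (hκ : 4 * d ≤ κ ^ 4)
    (hf : ∀ n, (freeCount d ℓ n : ℝ) ≤ 9 * κ ^ n) {U : Set (ℤ → Fin d)} {a b : ℤ} {L : ℕ}
    (hb : b = a + L) {s : ℕ} {Γ : ℝ} (hΓ0 : 0 ≤ Γ)
    (hΓ : ∀ i ≤ s, ∀ j ≤ s, (cnt (U ∩ (freeSet d ℓ (a - 4 * i) (b + 4 * j) ∩
      goodSet d (a - 4 * i) (b + 4 * j))) (a - 4 * i) (L + 4 * i + 4 * j) : ℝ) ≤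
        Γ * κ ^ (L + 4 * i + 4 * j)) :
    (cnt (U ∩ freeSet d ℓ (a - 4 * s) (b + 4 * s)) (a - 4 * s) (L + 4 * s + 4 * s) : ℝ) ≤
      (4 * Γ + 36 * (1 / 2) ^ s) * κ ^ (L + 4 * s + 4 * s) := by
  let D : ℕ → ℕ → Set (ℤ → Fin d) := fun i j => U ∩ freeSet d ℓ (a - 4 * i) (b + 4 * j)
  let E : ℕ → ℕ → Set (ℤ → Fin d) := fun i j =>
    D i j ∩ {x | PrefixGoodOn x (a - 4 * i) (b + 4 * j)}
  have hfree : ∀ (S : Set (ℤ → Fin d)) (u v : ℤ) (n : ℕ), v = u + n → S ⊆ freeSet d ℓ u v →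
      (cnt S u n : ℝ) ≤ 9 * κ ^ n := by
    intro S u v n hv hS
    subst hv
    refine le_trans ?_ (hf n)
    rw [← cnt_freeSet (d := d) (ℓ := ℓ) u n]
    exact_mod_cast cnt_mono hS _ _
  -- Strip on the right with the left margin fixed. `hfin` then strips on the left, with this bound
  -- as its irreducible part: `2 * (2 * Γ + 12 * e) + 12 * e = 4 * Γ + 36 * e` for `e = (1 / 2) ^
  -- s`.
  have hE : ∀ i ≤ s, (cnt (E i s) (a - 4 * i) (L + 4 * i + 4 * s) : ℝ) ≤
      (2 * Γ + 12 * (1 / 2) ^ s) * κ ^ (L + 4 * i + 4 * s) := by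
    intro i hi
    refine strip_bound hκ0 hκ (T := fun j => (cnt (E i j) (a - 4 * i) (L + 4 * i + 4 * j) : ℝ))
      (p := fun j => (cnt (U ∩ (freeSet d ℓ (a - 4 * i) (b + 4 * j) ∩
        goodSet d (a - 4 * i) (b + 4 * j))) (a - 4 * i) (L + 4 * i + 4 * j) : ℝ))
      (c := fun j m => (cnt (E i j) (a - 4 * i) (L + 4 * i + 4 * j - 4 * m) : ℝ)) hΓ0
      (fun _ => Nat.cast_nonneg _) (L + 4 * i) s ?_ ?_ ?_ (fun j hj => hΓ i hi j hj)
    · intro j hj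
      have h := cnt_le_suffixGood_add (E i j) (a - 4 * i) (L + 4 * i + 4 * j)
      rw [show a - 4 * i + ((L + 4 * i + 4 * j : ℕ) : ℤ) = b + 4 * j by push_cast; omega] at h
      have h' : E i j ∩ {x | SuffixGoodOn x (a - 4 * i) (b + 4 * j)} =
          U ∩ (freeSet d ℓ (a - 4 * i) (b + 4 * j) ∩ goodSet d (a - 4 * i) (b + 4 * j)) := by
        ext x
        simp only [E, D, goodSet, Set.mem_inter_iff, Set.mem_ofPred_eq, and_assoc]
      rw [h'] at h
      exact_mod_cast h
    · intro j hj m hm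
      rw [show L + 4 * i + 4 * j - 4 * m = L + 4 * i + 4 * (j - m) by omega]
      refine Nat.cast_le.2 (cnt_mono ?_ _ _)
      rintro x ⟨⟨hU, hx⟩, hx'⟩
      exact ⟨⟨hU, freeSet_anti le_rfl (by omega) hx⟩, hx'.mono (by omega)⟩
    · intro j hj m hm hm'
      refine hfree _ _ _ _ rfl (fun x hx => freeSet_anti le_rfl ?_ hx.1.2)
      omega
  have hfin := strip_bound hκ0 hκ
    (T := fun i => (cnt (D i s) (a - 4 * i) (L + 4 * s + 4 * i) : ℝ))
    (p := fun i => (cnt (E i s) (a - 4 * i) (L + 4 * s + 4 * i) : ℝ))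
    (c := fun i m => (cnt (D i s) (a - 4 * i + 4 * m) (L + 4 * s + 4 * i - 4 * m) : ℝ))
    (P := 2 * Γ + 12 * (1 / 2) ^ s) (by positivity) (fun _ => Nat.cast_nonneg _)
    (L + 4 * s) s ?_ ?_ ?_ ?_
  · refine hfin.trans (le_of_eq ?_)
    ring
  · intro i hi
    have h := cnt_le_prefixGood_add (D i s) (a - 4 * i) (L + 4 * s + 4 * i)
    rw [show a - 4 * i + ((L + 4 * s + 4 * i : ℕ) : ℤ) = b + 4 * s by push_cast; omega] at h
    exact_mod_cast h
  · intro i hi m hm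
    rw [show L + 4 * s + 4 * i - 4 * m = L + 4 * s + 4 * (i - m) by omega,
      show a - 4 * i + 4 * m = a - 4 * ((i - m : ℕ) : ℤ) by omega]
    refine Nat.cast_le.2 (cnt_mono ?_ _ _)
    rintro x ⟨hU, hx⟩
    exact ⟨hU, freeSet_anti (by omega) (by omega) hx⟩
  · intro i hi m hm hm'
    refine hfree _ _ _ _ rfl (fun x hx => freeSet_anti ?_ ?_ hx.2)
    · omega
    · omega
  · intro i hi
    have := hE i hi
    rw [show L + 4 * i + 4 * s = L + 4 * s + 4 * i by ring] at this
    exact this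

end Cores

/-! ### Frequencies of one word and of two distant words among free words -/

section TwoPoint

variable {d : ℕ} {ℓ : ℕ → ℕ}

/-- Good words grow exponentially in number, so a long gap has far more fillings than there are
periods to avoid. The factor `4` is what lets at least half of the concatenations survive in
`five_mul_cnt_le`. -/
theorem exists_gap (hd : 2 ≤ d) (hℓ : ∀ m, 0 < m → 12 * m ≤ ℓ m) (M : ℕ) :
    ∃ n₀, ∀ n, n₀ ≤ n → 4 * (M + n) ≤ goodCount d ℓ n := by
  obtain ⟨κ, hκ, hf⟩ := exists_growth_rate hd hℓ
  have hd' : (2 : ℝ) ≤ d := by exact_mod_cast hd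
  have hκ1 : 1 < κ := by linarith
  have t1 := tendsto_pow_const_div_const_pow_of_one_lt 1 hκ1
  have t0 := tendsto_pow_const_div_const_pow_of_one_lt 0 hκ1
  have t := (t0.const_mul (12 * M : ℝ)).add (t1.const_mul 12)
  simp only [mul_zero, add_zero] at t
  obtain ⟨n₀, hn₀⟩ := eventually_atTop.1 (t.eventually (gt_mem_nhds one_pos))
  refine ⟨n₀, fun n hn => ?_⟩
  have h1 := hn₀ n hn
  have hpos : 0 < κ ^ n := by positivity
  rw [pow_zero, pow_one, ← mul_div_assoc, ← mul_div_assoc, ← add_div, div_lt_one hpos] at h1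
  have h2 := freeCount_le_three_mul_goodCount hd hℓ n
  have h3 := (hf n).1
  have : (4 * (M + n) : ℝ) ≤ goodCount d ℓ n := by linarith
  exact_mod_cast this

/-- Good words `u`, `v` occur at distant prescribed positions in a proportion of about
`κ ^ (-|u| - |v|)` of all free words. -/
theorem freeCount_mul_le_cnt (hd : 2 ≤ d) (hℓ : ∀ m, 0 < m → 12 * m ≤ ℓ m) {κ : ℝ} (hκ0 : 0 < κ)
    (hf : ∀ n, κ ^ n ≤ freeCount d ℓ n ∧ (freeCount d ℓ n : ℝ) ≤ 9 * κ ^ n)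
    {p₀ p₁ p₂ p₃ p₄ p₅ : ℤ} {n₂ n₄ N : ℕ} (o₁ : p₀ ≤ p₁) (o₂ : p₂ = p₁ + n₂) (o₃ : p₂ ≤ p₃)
    (o₄ : p₄ = p₃ + n₄) (o₅ : p₄ ≤ p₅) (hN : p₅ = p₀ + N)
    (hgap : 4 * (n₂ + n₄ + (p₃ - p₂).toNat) ≤ goodCount d ℓ (p₃ - p₂).toNat)
    {S₂ S₄ : Set (ℤ → Fin d)} (l₂ : LocalOn S₂ p₁ p₂) (l₄ : LocalOn S₄ p₃ p₄)
    (h₂ : S₂ ⊆ freeSet d ℓ p₁ p₂ ∩ goodSet d p₁ p₂)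
    (h₄ : S₄ ⊆ freeSet d ℓ p₃ p₄ ∩ goodSet d p₃ p₄) :
    (freeCount d ℓ N : ℝ) * (cnt S₂ p₁ n₂ / κ ^ n₂ * (cnt S₄ p₃ n₄ / κ ^ n₄)) ≤
      486 * cnt (S₂ ∩ S₄ ∩ freeSet d ℓ p₀ p₅) p₀ N := by
  obtain ⟨n₁, hn₁⟩ := Int.le.dest o₁
  obtain ⟨n₃, hn₃⟩ := Int.le.dest o₃
  obtain ⟨n₅, hn₅⟩ := Int.le.dest o₅
  rw [show (p₃ - p₂).toNat = n₃ by omega] at hgap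
  have hNe : N = n₁ + n₂ + n₃ + n₄ + n₅ := by omega
  have hl := fun a b => (localOn_freeSet (d := d) ℓ a b).inter (localOn_goodSet a b)
  have key := five_mul_cnt_le hℓ hn₁.symm o₂ hn₃.symm o₄ hn₅.symm (hl _ _) l₂ (hl _ _) l₄ (hl _ _)
    le_rfl h₂ le_rfl h₄ le_rfl
  rw [← hNe] at key
  have e₁ := cnt_freeSet_inter_goodSet (d := d) (ℓ := ℓ) p₀ n₁
  have e₃ := cnt_freeSet_inter_goodSet (d := d) (ℓ := ℓ) p₂ n₃
  have e₅ := cnt_freeSet_inter_goodSet (d := d) (ℓ := ℓ) p₄ n₅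
  rw [hn₁] at e₁
  rw [hn₃] at e₃
  rw [hn₅] at e₅
  rw [e₁, e₃, e₅] at key
  set X := cnt (S₂ ∩ S₄ ∩ freeSet d ℓ p₀ p₅) p₀ N
  have key' : (goodCount d ℓ n₁ : ℝ) * cnt S₂ p₁ n₂ * goodCount d ℓ n₃ * cnt S₄ p₃ n₄ *
      goodCount d ℓ n₅ ≤ X + 2 * (n₂ + n₃ + n₄) *
      (goodCount d ℓ n₁ * cnt S₂ p₁ n₂ * (cnt S₄ p₃ n₄ * goodCount d ℓ n₅)) := by
    exact_mod_cast key
  have hgap' : (4 * (n₂ + n₄ + n₃) : ℝ) ≤ goodCount d ℓ n₃ := by exact_mod_cast hgap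
  have hg : ∀ n, κ ^ n ≤ 3 * goodCount d ℓ n := fun n =>
    (hf n).1.trans (freeCount_le_three_mul_goodCount hd hℓ n)
  set c₂ : ℝ := (cnt S₂ p₁ n₂ : ℝ) with hc₂
  set c₄ : ℝ := (cnt S₄ p₃ n₄ : ℝ) with hc₄
  have hc₂0 : 0 ≤ c₂ := Nat.cast_nonneg _
  have hc₄0 : 0 ≤ c₄ := Nat.cast_nonneg _
  set g₁ : ℝ := (goodCount d ℓ n₁ : ℝ) with hg₁
  set g₃ : ℝ := (goodCount d ℓ n₃ : ℝ) with hg₃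
  set g₅ : ℝ := (goodCount d ℓ n₅ : ℝ) with hg₅
  have hg₁0 : 0 ≤ g₁ := Nat.cast_nonneg _
  have hg₃0 : 0 ≤ g₃ := Nat.cast_nonneg _
  have hg₅0 : 0 ≤ g₅ := Nat.cast_nonneg _
  have hhalf : g₁ * g₃ * g₅ * (c₂ * c₄) ≤ 2 * X := by
    have : 2 * (2 * (n₂ + n₃ + n₄)) * (g₁ * c₂ * (c₄ * g₅)) ≤ g₃ * (g₁ * c₂ * (c₄ * g₅)) :=
      mul_le_mul_of_nonneg_right (by linarith) (by positivity)
    linarith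
  have hpow : κ ^ n₁ * κ ^ n₃ * κ ^ n₅ ≤ 27 * (g₁ * g₃ * g₅) := by
    calc κ ^ n₁ * κ ^ n₃ * κ ^ n₅ ≤ (3 * g₁) * (3 * g₃) * (3 * g₅) :=
          mul_le_mul (mul_le_mul (hg _) (hg _) (by positivity) (by positivity)) (hg _)
            (by positivity) (by positivity)
      _ = _ := by ring
  have hN' : κ ^ N = κ ^ n₁ * κ ^ n₃ * κ ^ n₅ * (κ ^ n₂ * κ ^ n₄) := by
    rw [hNe]; ring
  -- `486 = 9 * 27 * 2`: the upper bound for `freeCount`, a factor `3` for each of three good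
  -- fillers, and the half lost to forbidden powers.
  calc (freeCount d ℓ N : ℝ) * (c₂ / κ ^ n₂ * (c₄ / κ ^ n₄))
      ≤ (9 * κ ^ N) * (c₂ / κ ^ n₂ * (c₄ / κ ^ n₄)) :=
        mul_le_mul_of_nonneg_right (hf N).2 (by positivity)
    _ = 9 * (κ ^ n₁ * κ ^ n₃ * κ ^ n₅) * (c₂ * c₄) := by
        rw [hN']; field_simp
    _ ≤ 9 * (27 * (g₁ * g₃ * g₅)) * (c₂ * c₄) := by gcongr
    _ = 243 * (g₁ * g₃ * g₅ * (c₂ * c₄)) := by ring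
    _ ≤ 486 * X := by linarith

/-- The words of a free word in an inner window. -/
theorem cnt_free_inter_le {κ : ℝ} (hκ0 : 0 < κ)
    (hf : ∀ n, κ ^ n ≤ freeCount d ℓ n ∧ (freeCount d ℓ n : ℝ) ≤ 9 * κ ^ n)
    {S : Set (ℤ → Fin d)} {p₀ p₁ p₂ p₃ : ℤ} {n N : ℕ} (o₁ : p₀ ≤ p₁) (o₂ : p₂ = p₁ + n)
    (o₃ : p₂ ≤ p₃) (hN : p₃ = p₀ + N) :
    (cnt (freeSet d ℓ p₀ p₃ ∩ S) p₀ N : ℝ) ≤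
      81 * (cnt (S ∩ freeSet d ℓ p₁ p₂) p₁ n / κ ^ n) * freeCount d ℓ N := by
  obtain ⟨n₁, hn₁⟩ := Int.le.dest o₁
  obtain ⟨n₃, hn₃⟩ := Int.le.dest o₃
  have hNe : N = n₁ + n + n₃ := by omega
  have h1 := cnt_add_le (freeSet d ℓ p₀ p₃ ∩ S) p₀ (n₁ + n) n₃
  have h2 := cnt_add_le (freeSet d ℓ p₀ p₃ ∩ S) p₀ n₁ n
  have h3 : cnt (freeSet d ℓ p₀ p₃ ∩ S) p₀ n₁ ≤ freeCount d ℓ n₁ := by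
    rw [← cnt_freeSet (d := d) (ℓ := ℓ) p₀]
    exact cnt_mono (fun x hx => freeSet_anti le_rfl (by omega) hx.1) _ _
  have h4 : cnt (freeSet d ℓ p₀ p₃ ∩ S) (p₀ + (n₁ + n : ℕ)) n₃ ≤ freeCount d ℓ n₃ := by
    rw [← cnt_freeSet (d := d) (ℓ := ℓ) (p₀ + (n₁ + n : ℕ))]
    exact cnt_mono (fun x hx => freeSet_anti (by omega) (by omega) hx.1) _ _
  have h5 : cnt (freeSet d ℓ p₀ p₃ ∩ S) (p₀ + n₁) n ≤ cnt (S ∩ freeSet d ℓ p₁ p₂) p₁ n := by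
    rw [hn₁]
    refine cnt_mono ?_ _ _
    rintro x ⟨hx, hx'⟩
    exact ⟨hx', freeSet_anti (by omega) (by omega) hx⟩
  have h6 : cnt (freeSet d ℓ p₀ p₃ ∩ S) p₀ N ≤
      freeCount d ℓ n₁ * cnt (S ∩ freeSet d ℓ p₁ p₂) p₁ n * freeCount d ℓ n₃ := by
    rw [hNe]
    exact h1.trans (Nat.mul_le_mul (h2.trans (Nat.mul_le_mul h3 h5)) h4)
  have h7 : (cnt (freeSet d ℓ p₀ p₃ ∩ S) p₀ N : ℝ) ≤
      freeCount d ℓ n₁ * cnt (S ∩ freeSet d ℓ p₁ p₂) p₁ n * freeCount d ℓ n₃ := by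
    exact_mod_cast h6
  set c : ℝ := (cnt (S ∩ freeSet d ℓ p₁ p₂) p₁ n : ℝ)
  have hc : 0 ≤ c := Nat.cast_nonneg _
  -- The two outer pieces contribute a factor `9` each.
  calc _ ≤ _ := h7
    _ ≤ (9 * κ ^ n₁) * c * (9 * κ ^ n₃) := by
        refine mul_le_mul (mul_le_mul_of_nonneg_right (hf _).2 hc) (hf _).2 (Nat.cast_nonneg _) ?_
        positivity
    _ = 81 * (c / κ ^ n) * κ ^ N := by rw [hNe]; field_simp; ring
    _ ≤ _ := mul_le_mul_of_nonneg_left (hf N).1 (by positivity)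

end TwoPoint

/-! ### Sets depending on finitely many coordinates -/

section LocalSets

variable {d : ℕ}

/-- The sets that depend on finitely many coordinates. -/
def localSets (d : ℕ) : Set (Set (ℤ → Fin d)) := {U | ∃ a b, LocalOn U a b}

theorem LocalOn.exists_nat {U : Set (ℤ → Fin d)} {a b : ℤ} (h : LocalOn U a b) :
    ∃ r : ℕ, LocalOn U (-r) r :=
  ⟨a.natAbs + b.natAbs, h.mono (by omega) (by omega)⟩

theorem isSetAlgebra_localSets : IsSetAlgebra (localSets d) where
  empty_mem := ⟨0, 0, fun _ _ _ h => h.elim⟩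
  compl_mem := by
    rintro s ⟨a, b, h⟩
    exact ⟨a, b, h.compl⟩
  union_mem := by
    rintro s t ⟨a, b, h⟩ ⟨a', b', h'⟩
    refine ⟨min a a', max b b', fun x y hxy hx => ?_⟩
    rcases hx with hx | hx
    · exact Or.inl (h.mono (min_le_left _ _) (le_max_left _ _) hxy hx)
    · exact Or.inr (h'.mono (min_le_right _ _) (le_max_right _ _) hxy hx)

/-- Weak convergence of measures gives convergence of the measure of every clopen set, so bounds on
word counts pass to a limit measure. -/
theorem LocalOn.isClopen {U : Set (ℤ → Fin d)} {a b : ℤ} (h : LocalOn U a b) : IsClopen U := by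
  have hc : Continuous fun x : ℤ → Fin d => word x a (b - a).toNat := by
    unfold word
    fun_prop
  have : U = (fun x => word x a (b - a).toNat) ⁻¹' ((fun x => word x a (b - a).toNat) '' U) := by
    refine Set.Subset.antisymm (Set.subset_preimage_image _ _) ?_
    rintro x ⟨y, hy, hyx⟩
    simp only [word_eq_iff] at hyx
    exact h (hyx.mono (Set.Ico_subset_Ico le_rfl (by omega))) hy
  rw [this]
  exact (isClopen_discrete _).preimage hc

theorem LocalOn.measurableSet {U : Set (ℤ → Fin d)} {a b : ℤ} (h : LocalOn U a b) :
    MeasurableSet U :=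
  h.isClopen.isOpen.measurableSet

theorem generateFrom_localSets :
    (MeasurableSpace.pi : MeasurableSpace (ℤ → Fin d)) =
      MeasurableSpace.generateFrom (localSets d) := by
  refine le_antisymm (iSup_le fun i => ?_) (MeasurableSpace.generateFrom_le ?_)
  · rintro _ ⟨s, -, rfl⟩
    refine MeasurableSpace.measurableSet_generateFrom ⟨i, i + 1, fun x y hxy hx => ?_⟩
    have := hxy (show i ∈ Set.Ico i (i + 1) by simp)
    simpa [← this] using hx
  · rintro U ⟨a, b, h⟩
    exact h.measurableSet

theorem isPiSystem_localSets : IsPiSystem (localSets d) :=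
  fun _ hs _ ht _ => isSetAlgebra_localSets.inter_mem hs ht

theorem exists_local_symmDiff_lt (μ : Measure (ℤ → Fin d)) [IsFiniteMeasure μ]
    {E : Set (ℤ → Fin d)} (hE : MeasurableSet E) {ε : ℝ} (hε : 0 < ε) :
    ∃ (U : Set (ℤ → Fin d)) (r : ℕ), LocalOn U (-r) r ∧ μ.real (symmDiff E U) < ε := by
  have h := Measure.MeasureDense.of_generateFrom_isSetAlgebra_finite (μ := μ)
    isSetAlgebra_localSets generateFrom_localSets
  obtain ⟨U, ⟨a, b, hU⟩, hlt⟩ := h.approx E hE (measure_ne_top _ _) ε hε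
  obtain ⟨r, hr⟩ := hU.exists_nat
  refine ⟨U, r, hr, ?_⟩
  exact (ENNReal.lt_ofReal_iff_toReal_lt (measure_ne_top _ _)).1 hlt

end LocalSets

/-! ### An invariant limit of uniform distributions on free words -/

section LimitMeasure

variable {d : ℕ} {ℓ : ℕ → ℕ}

theorem measurable_shift (k : ℤ) : Measurable (shift k : (ℤ → Fin d) → ℤ → Fin d) :=
  (continuous_shift k).measurable

/-- Averages of a bounded sequence are controlled by its values away from the ends. -/
theorem average_le {a : ℕ → ℝ} {N r : ℕ} {c : ℝ} (hN : 0 < N) (ha : ∀ k, a k ≤ 1) (hc : 0 ≤ c)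
    (h : ∀ k, r ≤ k → k + r ≤ N → a k ≤ c) :
    (∑ k ∈ Finset.range N, a k) / N ≤ c + 2 * r / N := by
  have hN' : (0 : ℝ) < N := by exact_mod_cast hN
  rw [div_le_iff₀ hN', add_mul, div_mul_cancel₀ _ hN'.ne']
  have h1 : ∀ k ∈ Finset.range N, a k ≤ c +
      ((if k ∈ Finset.range r then (1 : ℝ) else 0) +
        if k ∈ Finset.Ico (N - r) N then (1 : ℝ) else 0) := by
    intro k hk
    rw [Finset.mem_range] at hk
    by_cases h1 : k < r
    · simp only [Finset.mem_range, h1, if_true]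
      have : (0 : ℝ) ≤ if k ∈ Finset.Ico (N - r) N then (1 : ℝ) else 0 := by positivity
      linarith [ha k]
    by_cases h2 : N - r ≤ k
    · have : k ∈ Finset.Ico (N - r) N := Finset.mem_Ico.2 ⟨h2, hk⟩
      simp only [this, if_true]
      have : (0 : ℝ) ≤ if k ∈ Finset.range r then (1 : ℝ) else 0 := by positivity
      linarith [ha k]
    · have h3 := h k (by omega) (by omega)
      have p1 : (0 : ℝ) ≤ if k ∈ Finset.range r then (1 : ℝ) else 0 := by positivity
      have p2 : (0 : ℝ) ≤ if k ∈ Finset.Ico (N - r) N then (1 : ℝ) else 0 := by positivity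
      linarith
  refine (Finset.sum_le_sum h1).trans ?_
  rw [Finset.sum_add_distrib, Finset.sum_add_distrib, Finset.sum_const, Finset.card_range,
    nsmul_eq_mul, Finset.sum_ite_mem, Finset.sum_ite_mem, Finset.sum_const, Finset.sum_const]
  have c1 : ((Finset.range N ∩ Finset.range r).card : ℝ) ≤ r := by
    exact_mod_cast (Finset.card_le_card Finset.inter_subset_right).trans (by simp)
  have c2 : ((Finset.range N ∩ Finset.Ico (N - r) N).card : ℝ) ≤ r := by
    exact_mod_cast (Finset.card_le_card Finset.inter_subset_right).trans
      (by rw [Nat.card_Ico]; omega)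
  simp only [nsmul_eq_mul, mul_one]
  linarith

/-- A set of representatives of the free words of length `N`. -/
theorem exists_representatives (d : ℕ) (ℓ : ℕ → ℕ) (N : ℕ) :
    ∃ R : Finset (ℤ → Fin d), ∀ S : Set (ℤ → Fin d), LocalOn S 0 N →
      ∀ [DecidablePred (· ∈ S)], (R.filter (· ∈ S)).card = cnt (freeSet d ℓ 0 N ∩ S) 0 N := by
  obtain ⟨R, hR, hb⟩ := (Set.surjOn_image (fun x => word x 0 N)
    (freeSet d ℓ 0 N)).exists_bijOn_subset
  have hfin : R.Finite := Set.Finite.of_finite_image (Set.toFinite _) hb.injOn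
  refine ⟨hfin.toFinset, fun S hS _ => ?_⟩
  rw [← Set.ncard_coe_finset, Finset.coe_filter]
  simp only [Set.Finite.mem_toFinset]
  unfold cnt
  have hinj : Set.InjOn (fun x => word x 0 N) {x | x ∈ R ∧ x ∈ S} :=
    hb.injOn.mono fun x hx => hx.1
  rw [← hinj.ncard_image]
  congr 1
  ext w
  constructor
  · rintro ⟨x, ⟨hx, hxS⟩, rfl⟩
    exact ⟨x, ⟨hR hx, hxS⟩, rfl⟩
  · rintro ⟨x, ⟨hx, hxS⟩, rfl⟩
    obtain ⟨y, hy, hyx⟩ := hb.surjOn ⟨x, hx, rfl⟩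
    refine ⟨y, ⟨hy, ?_⟩, hyx⟩
    simp only [word_eq_iff, zero_add] at hyx
    exact hS hyx.symm hxS

/-- The average over `k < N` of the uniform distributions on the `k`-shifts of `R`. -/
noncomputable def averagedMeasure (R : Finset (ℤ → Fin d)) (N : ℕ) : Measure (ℤ → Fin d) :=
  ((N : ENNReal) * R.card)⁻¹ • ∑ k ∈ Finset.range N, ∑ x ∈ R, Measure.dirac (shift (k : ℤ) x)

open Classical in
theorem averagedMeasure_real_apply (R : Finset (ℤ → Fin d)) (N : ℕ)
    {U : Set (ℤ → Fin d)} (hU : MeasurableSet U) :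
    (averagedMeasure R N).real U =
      (∑ k ∈ Finset.range N, ((R.filter (· ∈ shift (k : ℤ) ⁻¹' U)).card : ℝ) / R.card) / N := by
  have h : ∀ k, ∑ x ∈ R, (Measure.dirac (shift (k : ℤ) x) : Measure (ℤ → Fin d)) U =
      ((R.filter (· ∈ shift (k : ℤ) ⁻¹' U)).card : ENNReal) := by
    intro k
    simp only [Measure.dirac_apply' _ hU, Set.indicator_apply, Pi.one_apply]
    rw [Finset.sum_ite]
    simp
  simp only [averagedMeasure, Measure.real, Measure.smul_apply, Measure.finsetSum_apply,
    smul_eq_mul, h, ENNReal.toReal_mul, ENNReal.toReal_inv, ENNReal.toReal_natCast]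
  rw [← Nat.cast_sum, ENNReal.toReal_natCast, Nat.cast_sum, ← Finset.sum_div]
  field_simp

theorem isProbabilityMeasure_averagedMeasure {R : Finset (ℤ → Fin d)} {N : ℕ} (hR : 0 < R.card)
    (hN : 0 < N) : IsProbabilityMeasure (averagedMeasure R N) := by
  constructor
  simp only [averagedMeasure, Measure.smul_apply, Measure.finsetSum_apply, measure_univ,
    Finset.sum_const, Finset.card_range, nsmul_eq_mul, mul_one, smul_eq_mul]
  refine ENNReal.inv_mul_cancel ?_ ?_
  · simp only [ne_eq, mul_eq_zero, Nat.cast_eq_zero, not_or]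
    exact ⟨hN.ne', hR.ne'⟩
  · exact ENNReal.mul_ne_top (ENNReal.natCast_ne_top _) (ENNReal.natCast_ne_top _)

/-- The measure is a limit of `averagedMeasure` along an ultrafilter, which exists by compactness. A
bound valid at all positions `k` whose window fits in `[0, N)` passes to the limit, because the
remaining positions, at most `2 * r` of them, have vanishing weight. -/
theorem exists_limit_measure (hd : 2 ≤ d) (hℓ : ∀ m, 0 < m → 12 * m ≤ ℓ m) :
    ∃ μ : Measure (ℤ → Fin d), IsProbabilityMeasure μ ∧ MeasurePreserving (shift 1) μ μ ∧
      (∀ (U : Set (ℤ → Fin d)) (r : ℕ), LocalOn U (-r) r → ∀ c : ℝ, 0 ≤ c →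
        (∀ N k : ℕ, r ≤ k → k + r ≤ N →
          (cnt (freeSet d ℓ 0 N ∩ shift (k : ℤ) ⁻¹' U) 0 N : ℝ) ≤ c * freeCount d ℓ N) →
        μ.real U ≤ c) ∧
      (∀ (U : Set (ℤ → Fin d)) (r : ℕ), LocalOn U (-r) r → ∀ c : ℝ,
        (∀ N k : ℕ, r ≤ k → k + r ≤ N →
          c * freeCount d ℓ N ≤ (cnt (freeSet d ℓ 0 N ∩ shift (k : ℤ) ⁻¹' U) 0 N : ℝ)) →
        c ≤ μ.real U) := by
  classical
  choose R hR using exists_representatives d ℓ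
  have hcard : ∀ N, (R N).card = freeCount d ℓ N := fun N => by
    have := hR N Set.univ (localOn_univ _ _)
    simpa [freeCount] using this
  have hpos : ∀ N, 0 < (R N).card := fun N => by rw [hcard]; exact freeCount_pos hd hℓ N
  let μs : ℕ → ProbabilityMeasure (ℤ → Fin d) := fun N =>
    ⟨averagedMeasure (R (N + 1)) (N + 1), isProbabilityMeasure_averagedMeasure (hpos _) (by omega)⟩
  let 𝒰 : Ultrafilter ℕ := hyperfilter ℕ
  have h𝒰 : (𝒰 : Filter ℕ) ≤ atTop := Nat.hyperfilter_le_atTop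
  let μ : ProbabilityMeasure (ℤ → Fin d) := (𝒰.map μs).lim
  have hlim : Tendsto μs 𝒰 (nhds μ) := (𝒰.map μs).le_nhds_lim
  let a : Set (ℤ → Fin d) → ℕ → ℕ → ℝ := fun U N k =>
    (((R N).filter (· ∈ shift (k : ℤ) ⁻¹' U)).card : ℝ) / (R N).card
  have ha0 : ∀ U N k, 0 ≤ a U N k := fun U N k => by positivity
  have ha1 : ∀ U N k, a U N k ≤ 1 := fun U N k =>
    div_le_one_of_le₀ (by exact_mod_cast Finset.card_filter_le _ _) (Nat.cast_nonneg _)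
  have hconv : ∀ U b c, LocalOn U b c →
      Tendsto (fun N : ℕ => (∑ k ∈ Finset.range (N + 1), a U (N + 1) k) / ((N + 1 : ℕ) : ℝ)) 𝒰
        (nhds ((μ : Measure (ℤ → Fin d)).real U)) := by
    intro U b c hU
    have h := ProbabilityMeasure.tendsto_measure_of_isClopen_of_tendsto hlim hU.isClopen
    have h' := (NNReal.continuous_coe.tendsto _).comp h
    refine h'.congr fun N => ?_
    exact averagedMeasure_real_apply (R (N + 1)) (N + 1) hU.measurableSet
  have hcnt : ∀ (U : Set (ℤ → Fin d)) (r N k : ℕ), LocalOn U (-r) r → r ≤ k → k + r ≤ N →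
      a U N k = (cnt (freeSet d ℓ 0 N ∩ shift (k : ℤ) ⁻¹' U) 0 N : ℝ) / freeCount d ℓ N := by
    intro U r N k hU hrk hkN
    simp only [a]
    rw [hR N _ ((hU.shift_preimage k).mono (by omega) (by omega)), hcard]
  have hzero : ∀ c : ℝ, Tendsto (fun N : ℕ => c / ((N + 1 : ℕ) : ℝ)) 𝒰 (nhds 0) := fun c =>
    ((tendsto_const_div_atTop_nhds_zero_nat c).comp (tendsto_add_atTop_nat 1)).mono_left h𝒰
  have hfpos : ∀ N, (0 : ℝ) < freeCount d ℓ N := fun N => by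
    exact_mod_cast freeCount_pos hd hℓ N
  refine ⟨μ, inferInstance, ⟨measurable_shift 1, ?_⟩, ?_, ?_⟩
  · have : IsProbabilityMeasure (Measure.map (shift 1) (μ : Measure (ℤ → Fin d))) :=
      Measure.isProbabilityMeasure_map (measurable_shift 1).aemeasurable
    refine ext_of_generate_finite _ generateFrom_localSets isPiSystem_localSets ?_ (by simp)
    rintro U ⟨b, c, hU⟩
    rw [Measure.map_apply (measurable_shift 1) hU.measurableSet]
    have t1 := hconv U b c hU
    have t2 := hconv _ _ _ (hU.shift_preimage 1)
    have hshift : ∀ N k, a (shift 1 ⁻¹' U) N k = a U N (k + 1) := by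
      intro N k
      simp only [a]
      rw [← Set.preimage_comp]
      congr 5
      funext x
      simp only [Set.mem_preimage, Function.comp_apply, ← shift_add, Nat.cast_add, Nat.cast_one]
    -- The two averages telescope to a difference of boundary terms of order `1 / N`.
    have t3 : Tendsto (fun N : ℕ =>
        (∑ k ∈ Finset.range (N + 1), a (shift 1 ⁻¹' U) (N + 1) k) / ((N + 1 : ℕ) : ℝ) -
        (∑ k ∈ Finset.range (N + 1), a U (N + 1) k) / ((N + 1 : ℕ) : ℝ)) 𝒰 (nhds 0) := by
      have e : ∀ N : ℕ, (∑ k ∈ Finset.range (N + 1), a (shift 1 ⁻¹' U) (N + 1) k) /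
            ((N + 1 : ℕ) : ℝ) - (∑ k ∈ Finset.range (N + 1), a U (N + 1) k) / ((N + 1 : ℕ) : ℝ) =
          (a U (N + 1) (N + 1) - a U (N + 1) 0) / ((N + 1 : ℕ) : ℝ) := by
        intro N
        rw [← sub_div, ← Finset.sum_sub_distrib]
        simp only [hshift]
        rw [Finset.sum_range_sub (fun k => a U (N + 1) k)]
      refine tendsto_of_tendsto_of_tendsto_of_le_of_le (hzero (-1)) (hzero 1) ?_ ?_
      · intro N
        simp only [e]
        have := ha0 U (N + 1) (N + 1)
        have := ha1 U (N + 1) 0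
        gcongr
        linarith
      · intro N
        simp only [e]
        have := ha1 U (N + 1) (N + 1)
        have := ha0 U (N + 1) 0
        gcongr
        linarith
    have heq := tendsto_nhds_unique (t2.sub t1) t3
    have heq' : (μ : Measure (ℤ → Fin d)).real (shift 1 ⁻¹' U) =
        (μ : Measure (ℤ → Fin d)).real U := by linarith
    exact (measureReal_eq_measureReal_iff).1 heq'
  · intro U r hU c hc h
    have t := (hzero (2 * r)).const_add c
    rw [add_zero] at t
    refine le_of_tendsto_of_tendsto' (hconv U _ _ hU) t fun N => ?_
    refine average_le (by omega) (ha1 U _) hc fun k h1 h2 => ?_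
    rw [hcnt U r _ k hU h1 h2, div_le_iff₀ (hfpos _)]
    exact h _ k h1 h2
  · intro U r hU c h
    -- `average_le` is applied below to the complementary frequencies with the bound `1 - c`, which
    -- has to be nonnegative.
    have hc1 : c ≤ 1 := by
      have h1 := h (r + r) r le_rfl le_rfl
      have h2 : (cnt (freeSet d ℓ 0 (r + r : ℕ) ∩ shift (r : ℤ) ⁻¹' U) 0 (r + r) : ℝ) ≤
          freeCount d ℓ (r + r) := by exact_mod_cast cnt_mono Set.inter_subset_left _ _
      have := hfpos (r + r)
      by_contra! hc
      nlinarith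
    have t := ((hzero (2 * r)).const_add (1 - c)).const_sub 1
    rw [add_zero, sub_sub_cancel] at t
    refine le_of_tendsto_of_tendsto' t (hconv U _ _ hU) fun N => ?_
    have h3 := average_le (a := fun k => 1 - a U (N + 1) k) (N := N + 1) (r := r) (c := 1 - c)
      (by omega) (fun k => by linarith [ha0 U (N + 1) k]) (by linarith) (fun k h1 h2 => by
        rw [hcnt U r _ k hU h1 h2]
        have := (le_div_iff₀ (hfpos (N + 1))).2 (h _ k h1 h2)
        linarith)
    rw [Finset.sum_sub_distrib, Finset.sum_const, Finset.card_range, nsmul_eq_mul, mul_one, sub_div,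
      div_self (by positivity)] at h3
    linarith

end LimitMeasure

/-! ### Gibbs bounds and ergodicity -/

section Gibbs

variable {d : ℕ} {ℓ : ℕ → ℕ}

/-- The number of free words on the window `[-r - 4 s, r + 4 s)` that lie in `U`, normalised by
the exponential growth rate. -/
noncomputable def density (ℓ : ℕ → ℕ) (κ : ℝ) (U : Set (ℤ → Fin d)) (r s : ℕ) : ℝ :=
  cnt (U ∩ freeSet d ℓ (-r - 4 * s) (r + 4 * s)) (-r - 4 * s) (2 * r + 4 * s + 4 * s) /
    κ ^ (2 * r + 4 * s + 4 * s)

/-- An invariant measure with the upper Gibbs bound for all words and a lower Gibbs bound for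
pairs of distant good words. -/
structure IsGibbs (ℓ : ℕ → ℕ) (κ : ℝ) (μ : Measure (ℤ → Fin d)) : Prop where
  prob : IsProbabilityMeasure μ
  invariant : MeasurePreserving (shift 1) μ μ
  le : ∀ (U : Set (ℤ → Fin d)) (a : ℤ) (n : ℕ), LocalOn U a (a + n) →
    μ.real U ≤ 81 * (cnt (U ∩ freeSet d ℓ a (a + n)) a n / κ ^ n)
  mul_le : ∀ (U V : Set (ℤ → Fin d)) (r s : ℕ), LocalOn U (-r) r → LocalOn V (-r) r →
    ∃ t : ℕ, density ℓ κ U r s * density ℓ κ V r s ≤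
      7776 * μ.real (U ∩ shift (t : ℤ) ⁻¹' V) + 3888 * (1 / 2) ^ s

/-- For the pair bound, `U` and `V` are enlarged by margins to events on good words, which can be
joined. The error `(1 / 2) ^ s` accounts for words from which stripping fourth powers reaches into
the central window. -/
theorem exists_isGibbs (hd : 2 ≤ d) (hℓ : ∀ m, 0 < m → 12 * m ≤ ℓ m) {κ : ℝ}
    (hκ : (7 * d / 8 : ℝ) ≤ κ)
    (hf : ∀ n, κ ^ n ≤ freeCount d ℓ n ∧ (freeCount d ℓ n : ℝ) ≤ 9 * κ ^ n) :
    ∃ μ : Measure (ℤ → Fin d), IsGibbs ℓ κ μ := by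
  have hd' : (2 : ℝ) ≤ d := by exact_mod_cast hd
  have hκ0 : 0 < κ := by linarith
  have hκ4 : 4 * d ≤ κ ^ 4 := le_pow_four_of_le hd hκ
  obtain ⟨μ, hprob, hinv, hup, hlow⟩ := exists_limit_measure hd hℓ
  refine ⟨μ, hprob, hinv, ?_, ?_⟩
  · intro U a n hU
    refine hup U (a.natAbs + (a + n).natAbs) (hU.mono (by omega) (by omega)) _ (by positivity) ?_
    intro N k h1 h2
    have h := cnt_free_inter_le hκ0 hf (S := shift (k : ℤ) ⁻¹' U) (p₀ := 0) (p₁ := k + a)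
      (p₂ := k + (a + n)) (p₃ := N) (n := n) (N := N) (by omega) (by omega) (by omega) (by omega)
    rwa [← shift_preimage_freeSet, ← Set.preimage_inter, cnt_shift_preimage] at h
  · intro U V r s hU hV
    let core : Set (ℤ → Fin d) → ℕ × ℕ → Set (ℤ → Fin d) := fun S p =>
      S ∩ (freeSet d ℓ (-r - 4 * p.1) (r + 4 * p.2) ∩ goodSet d (-r - 4 * p.1) (r + 4 * p.2))
    let len : ℕ × ℕ → ℕ := fun p => 2 * r + 4 * p.1 + 4 * p.2
    let γ : Set (ℤ → Fin d) → ℕ × ℕ → ℝ := fun S p =>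
      cnt (core S p) (-r - 4 * p.1) (len p) / κ ^ len p
    have hγ0 : ∀ S p, 0 ≤ γ S p := fun S p => by positivity
    have hγ9 : ∀ S p, γ S p ≤ 9 := fun S p => by
      rw [div_le_iff₀ (by positivity)]
      refine le_trans ?_ (hf (len p)).2
      rw [← cnt_freeSet (d := d) (ℓ := ℓ) (-r - 4 * p.1)]
      refine Nat.cast_le.2 (cnt_mono (fun x hx => freeSet_anti le_rfl ?_ hx.2.1) _ _)
      simp only [len]
      push_cast
      omega
    -- Joining needs one fixed pair of margins. The pair with the most good words, relative to `κ ^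
    -- len`, provides the `Γ` of `cnt_le_of_goodCores`.
    have hmax : ∀ S, ∃ p : ℕ × ℕ, p.1 ≤ s ∧ p.2 ≤ s ∧ ∀ i ≤ s, ∀ j ≤ s, γ S (i, j) ≤ γ S p := by
      intro S
      obtain ⟨p, hp, hle⟩ := Finset.exists_max_image
        (Finset.range (s + 1) ×ˢ Finset.range (s + 1)) (γ S) ⟨(0, 0), by simp⟩
      simp only [Finset.mem_product, Finset.mem_range] at hp hle
      exact ⟨p, by omega, by omega, fun i hi j hj => hle (i, j) ⟨by omega, by omega⟩⟩
    have hdens : ∀ S p, (∀ i ≤ s, ∀ j ≤ s, γ S (i, j) ≤ γ S p) →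
        density ℓ κ S r s ≤ 4 * γ S p + 36 * (1 / 2) ^ s := by
      intro S p hp
      unfold density
      rw [div_le_iff₀ (by positivity)]
      refine cnt_le_of_goodCores hκ0 hκ4 (fun n => (hf n).2) (a := -r) (b := r) (L := 2 * r)
        (by push_cast; omega) (hγ0 S p) fun i hi j hj => ?_
      have := hp i hi j hj
      rwa [div_le_iff₀ (by positivity)] at this
    obtain ⟨p, hp1, hp2, hpm⟩ := hmax U
    obtain ⟨q, hq1, hq2, hqm⟩ := hmax V
    obtain ⟨n₀, hn₀⟩ := exists_gap hd hℓ (len p + len q)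
    -- With this displacement the gap between the two enlarged windows is exactly `n₀`.
    let t : ℕ := n₀ + 2 * r + 4 * p.2 + 4 * q.1
    have hlenp : len p = 2 * r + 4 * p.1 + 4 * p.2 := rfl
    have hlenq : len q = 2 * r + 4 * q.1 + 4 * q.2 := rfl
    have ht : t = n₀ + 2 * r + 4 * p.2 + 4 * q.1 := rfl
    have hlocal : ∀ S, LocalOn S (-r) r → ∀ p : ℕ × ℕ,
        LocalOn (core S p) (-r - 4 * p.1) (r + 4 * p.2) := fun S hS p =>
      (hS.mono (by omega) (by omega)).inter ((localOn_freeSet _ _ _).inter (localOn_goodSet _ _))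
    refine ⟨t, ?_⟩
    have hW : γ U p * γ V q / 486 ≤ μ.real (U ∩ shift (t : ℤ) ⁻¹' V) := by
      -- This radius keeps both enlarged windows inside `[0, N)`.
      refine hlow _ (t + r + 4 * p.1 + 4 * q.2)
        ((hU.mono (by push_cast; omega) (by push_cast; omega)).inter
          ((hV.shift_preimage t).mono (by push_cast; omega) (by push_cast; omega))) _ ?_
      intro N k h1 h2
      have key := freeCount_mul_le_cnt hd hℓ hκ0 hf (p₀ := 0) (p₁ := k + (-r - 4 * p.1))
        (p₂ := k + (r + 4 * p.2)) (p₃ := (k + t : ℤ) + (-r - 4 * q.1))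
        (p₄ := (k + t : ℤ) + (r + 4 * q.2)) (p₅ := N) (n₂ := len p) (n₄ := len q) (N := N)
        (by omega) (by omega) (by omega) (by omega) (by omega) (by omega) ?_
        ((hlocal U hU p).shift_preimage k) ((hlocal V hV q).shift_preimage (k + t)) ?_ ?_
      · rw [cnt_shift_preimage, cnt_shift_preimage] at key
        have hsub : shift (k : ℤ) ⁻¹' core U p ∩ shift (k + t : ℤ) ⁻¹' core V q ∩
            freeSet d ℓ 0 N ⊆ freeSet d ℓ 0 N ∩ shift (k : ℤ) ⁻¹' (U ∩ shift (t : ℤ) ⁻¹' V) := by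
          rintro x ⟨⟨hx1, hx2⟩, hx3⟩
          refine ⟨hx3, hx1.1, ?_⟩
          have := hx2.1
          rwa [shift_add] at this
        have hle := Nat.cast_le (α := ℝ).2 (cnt_mono hsub 0 N)
        simp only [γ]
        linarith
      · have hg : (((k + t : ℤ) + (-r - 4 * q.1)) - (k + (r + 4 * p.2))).toNat = n₀ := by omega
        rw [hg]
        exact hn₀ n₀ le_rfl
      · rw [← shift_preimage_freeSet, ← shift_preimage_goodSet, ← Set.preimage_inter]
        exact Set.preimage_mono Set.inter_subset_right
      · rw [← shift_preimage_freeSet, ← shift_preimage_goodSet, ← Set.preimage_inter]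
        exact Set.preimage_mono Set.inter_subset_right
    have d1 := hdens U p hpm
    have d2 := hdens V q hqm
    have e0 : (0 : ℝ) ≤ (1 / 2) ^ s := by positivity
    have e1 : ((1 : ℝ) / 2) ^ s ≤ 1 := pow_le_one₀ (by norm_num) (by norm_num)
    have dV0 : 0 ≤ density ℓ κ V r s := by unfold density; positivity
    have g1 := hγ0 U p
    have g2 := hγ0 V q
    have g3 := hγ9 U p
    have g4 := hγ9 V q
    set e : ℝ := (1 / 2) ^ s
    -- Here `7776 = 16 * 486` and `3888 = 144 * 18 + 1296`.
    calc density ℓ κ U r s * density ℓ κ V r s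
        ≤ (4 * γ U p + 36 * e) * (4 * γ V q + 36 * e) :=
          mul_le_mul d1 d2 dV0 (by positivity)
      _ = 16 * (γ U p * γ V q) + 144 * ((γ U p + γ V q) * e) + 1296 * (e * e) := by ring
      _ ≤ 7776 * μ.real (U ∩ shift (t : ℤ) ⁻¹' V) + 144 * (18 * e) + 1296 * e := by
          have i1 : (γ U p + γ V q) * e ≤ 18 * e := mul_le_mul_of_nonneg_right (by linarith) e0
          have i2 : e * e ≤ e := mul_le_of_le_one_left e0 e1
          linarith
      _ = _ := by ring

theorem IsGibbs.le_density {κ : ℝ} {μ : Measure (ℤ → Fin d)} (h : IsGibbs ℓ κ μ)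
    {U : Set (ℤ → Fin d)} {r : ℕ} (hU : LocalOn U (-r) r) (s : ℕ) :
    μ.real U ≤ 81 * density ℓ κ U r s := by
  have := h.le U (-r - 4 * s) (2 * r + 4 * s + 4 * s) (hU.mono (by omega) (by push_cast; omega))
  rwa [show (-r - 4 * s : ℤ) + ((2 * r + 4 * s + 4 * s : ℕ) : ℤ) = r + 4 * s by
    push_cast; ring] at this

/-- The pair bound with `V = Set.univ`, whose density is at least `1`. -/
theorem IsGibbs.density_le {κ : ℝ} (hκ0 : 0 < κ) (hf : ∀ n, κ ^ n ≤ freeCount d ℓ n)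
    {μ : Measure (ℤ → Fin d)} (h : IsGibbs ℓ κ μ)
    {U : Set (ℤ → Fin d)} {r : ℕ} (hU : LocalOn U (-r) r) (s : ℕ) :
    density ℓ κ U r s ≤ 7776 * μ.real U + 3888 * (1 / 2) ^ s := by
  have := h.prob
  obtain ⟨t, ht⟩ := h.mul_le U Set.univ r s hU (localOn_univ _ _)
  rw [Set.preimage_univ, Set.inter_univ] at ht
  have h1 : 1 ≤ density ℓ κ (Set.univ : Set (ℤ → Fin d)) r s := by
    unfold density
    rw [one_le_div (by positivity)]
    refine (hf _).trans (Nat.cast_le.2 ?_)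
    rw [← cnt_freeSet (-r - 4 * s), Set.univ_inter]
    refine cnt_mono (freeSet_anti le_rfl ?_) _ _
    push_cast
    omega
  have h0 : 0 ≤ density ℓ κ U r s := by unfold density; positivity
  exact (le_mul_of_one_le_right h0 h1).trans ht

theorem IsGibbs.measure_compl_freeSet {κ : ℝ} {μ : Measure (ℤ → Fin d)} (h : IsGibbs ℓ κ μ)
    (r : ℕ) : μ (freeSet d ℓ (-r) r)ᶜ = 0 := by
  have := h.prob
  have h1 := h.le (freeSet d ℓ (-r) r)ᶜ (-r) (2 * r)
    ((localOn_freeSet _ _ _).compl.mono le_rfl (by push_cast; omega))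
  rw [show (-r : ℤ) + ((2 * r : ℕ) : ℤ) = r by push_cast; ring, Set.compl_inter_self,
    cnt_empty] at h1
  simp only [Nat.cast_zero, zero_div, mul_zero] at h1
  exact (measureReal_eq_zero_iff).1 (le_antisymm h1 measureReal_nonneg)

theorem shift_preimage_of_invariant {E : Set (ℤ → Fin d)} (h : shift 1 ⁻¹' E = E) (t : ℕ) :
    shift (t : ℤ) ⁻¹' E = E := by
  induction t with
  | zero => ext x; simp
  | succ t ih =>
    have : (shift ((t + 1 : ℕ) : ℤ) : (ℤ → Fin d) → ℤ → Fin d) = shift 1 ∘ shift (t : ℤ) := by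
      funext x
      rw [Function.comp_apply, ← shift_add]
      push_cast
      rfl
    rw [this, Set.preimage_comp, h, ih]

theorem measurePreserving_shift_nat {ν : Measure (ℤ → Fin d)}
    (h : MeasurePreserving (shift 1) ν ν) (t : ℕ) : MeasurePreserving (shift (t : ℤ)) ν ν := by
  induction t with
  | zero =>
    have : (shift ((0 : ℕ) : ℤ) : (ℤ → Fin d) → ℤ → Fin d) = id := by funext x; simp
    rw [this]
    exact MeasurePreserving.id ν
  | succ t ih =>
    have : (shift ((t + 1 : ℕ) : ℤ) : (ℤ → Fin d) → ℤ → Fin d) = shift 1 ∘ shift (t : ℤ) := by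
      funext x
      rw [Function.comp_apply, ← shift_add]
      push_cast
      rfl
    rw [this]
    exact h.comp ih

/-- Approximate an invariant `E` by a local `U`. As `E` is invariant, `U ∩ shift t ⁻¹' Uᶜ` is nearly
null for every `t`, so the pair bound makes `μ(U) * μ(Uᶜ)` small. Hence `μ(E) * (1 - μ(E)) = 0`. -/
theorem IsGibbs.ergodic {κ : ℝ} {μ : Measure (ℤ → Fin d)} (h : IsGibbs ℓ κ μ) :
    Ergodic (shift 1) μ := by
  have := h.prob
  refine ⟨h.invariant, ⟨fun {E} hE hinv => ?_⟩⟩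
  rw [eventuallyConst_set']
  -- The factor `6561 = 81 ^ 2` comes from `le_density` for `U` and for its complement, and `7776`
  -- from the pair bound.
  let K : ℝ := 6561 * 7776
  have key : ∀ ε : ℝ, 0 < ε → μ.real E * (1 - μ.real E) ≤ (2 * K + 3) * ε := by
    intro ε hε
    obtain ⟨U, r, hU, hlt⟩ := exists_local_symmDiff_lt μ hE hε
    have d1 : μ.real (E \ U) ≤ ε :=
      (measureReal_mono (by intro x hx; exact Or.inl hx)).trans hlt.le
    have d2 : μ.real (U \ E) ≤ ε :=
      (measureReal_mono (by intro x hx; exact Or.inr hx)).trans hlt.le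
    have hUm := hU.measurableSet
    have hEU : μ.real E ≤ μ.real U + ε := by
      have : μ.real E ≤ μ.real U + μ.real (E \ U) :=
        (measureReal_mono (by intro x hx; by_cases hxU : x ∈ U <;> simp [hx, hxU])).trans
          (measureReal_union_le _ _)
      linarith
    have hUE : μ.real U ≤ μ.real E + ε := by
      have : μ.real U ≤ μ.real E + μ.real (U \ E) :=
        (measureReal_mono (by intro x hx; by_cases hxU : x ∈ E <;> simp [hx, hxU])).trans
          (measureReal_union_le _ _)
      linarith
    obtain ⟨s, hs⟩ := exists_pow_lt_of_lt_one (y := (1 / 2 : ℝ))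
      (show 0 < ε / (6561 * 3888) by positivity) (by norm_num)
    obtain ⟨t, ht⟩ := h.mul_le U Uᶜ r s hU hU.compl
    have b1 := h.le_density hU s
    have b2 := h.le_density hU.compl s
    have hcap : μ.real (U ∩ shift (t : ℤ) ⁻¹' Uᶜ) ≤ 2 * ε := by
      have hpre := shift_preimage_of_invariant hinv t
      have hsub : U ∩ shift (t : ℤ) ⁻¹' Uᶜ ⊆ (U \ E) ∪ shift (t : ℤ) ⁻¹' (E \ U) := by
        rintro x ⟨hx1, hx2⟩
        by_cases hxE : x ∈ E
        · refine Or.inr ⟨?_, hx2⟩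
          rw [← hpre] at hxE
          exact hxE
        · exact Or.inl ⟨hx1, hxE⟩
      have hmp := (measurePreserving_shift_nat h.invariant t).measureReal_preimage
        (hE.diff hUm).nullMeasurableSet
      have := (measureReal_mono (μ := μ) hsub).trans (measureReal_union_le _ _)
      linarith
    have hprod : μ.real U * μ.real Uᶜ ≤ 2 * K * ε + ε := by
      have e1 : μ.real U * μ.real Uᶜ ≤
          (81 * density ℓ κ U r s) * (81 * density ℓ κ Uᶜ r s) :=
        mul_le_mul b1 b2 measureReal_nonneg (measureReal_nonneg.trans b1)
      have e2 : 6561 * 3888 * (1 / 2 : ℝ) ^ s < ε := by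
        rwa [lt_div_iff₀ (by norm_num), mul_comm] at hs
      simp only [K]
      linarith
    rw [measureReal_compl hUm, probReal_univ] at hprod
    have p1 := measureReal_nonneg (μ := μ) (s := U)
    have p2 : μ.real U ≤ 1 := measureReal_le_one
    have p3 := measureReal_nonneg (μ := μ) (s := E)
    have p4 : μ.real E ≤ 1 := measureReal_le_one
    nlinarith
  have h0 : μ.real E * (1 - μ.real E) ≤ 0 := by
    refine le_of_forall_pos_le_add fun ε hε => ?_
    have hK : 0 < 2 * K + 3 := by simp only [K]; norm_num
    have := key (ε / (2 * K + 3)) (by positivity)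
    rw [mul_div_cancel₀ _ hK.ne'] at this
    linarith
  have p3 := measureReal_nonneg (μ := μ) (s := E)
  have p4 : μ.real E ≤ 1 := measureReal_le_one
  rcases eq_or_lt_of_le p3 with hz | hz
  · left
    rw [ae_eq_empty]
    exact (measureReal_eq_zero_iff).1 hz.symm
  · right
    have : μ.real E = 1 := by nlinarith
    rw [ae_eq_univ, ← measureReal_eq_zero_iff, measureReal_compl hE, probReal_univ, this, sub_self]

end Gibbs

/-! ### Entropy estimates and absolute continuity -/

section Entropy

variable {d : ℕ} {ℓ : ℕ → ℕ}

/-- **Gibbs' inequality**. -/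
theorem sum_negMulLog_le {α : Type*} [Fintype α] {p q : α → ℝ} (hp : ∀ a, 0 ≤ p a)
    (hq : ∀ a, 0 ≤ q a) (hpq : ∀ a, p a ≠ 0 → q a ≠ 0) (h : ∑ a, q a ≤ ∑ a, p a) :
    ∑ a, Real.negMulLog (p a) ≤ ∑ a, p a * -Real.log (q a) := by
  have key : ∀ a, Real.negMulLog (p a) - p a * -Real.log (q a) ≤ q a - p a := by
    intro a
    rcases eq_or_lt_of_le (hp a) with h0 | h0
    · rw [← h0]; simpa using hq a
    · have hq0 : 0 < q a := lt_of_le_of_ne (hq a) (hpq a h0.ne').symm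
      have h1 := Real.log_le_sub_one_of_pos (div_pos hq0 h0)
      rw [Real.log_div hq0.ne' h0.ne'] at h1
      have h2 := mul_le_mul_of_nonneg_left h1 h0.le
      rw [mul_sub, mul_sub, mul_div_cancel₀ _ h0.ne', mul_one] at h2
      rw [Real.negMulLog]
      linarith
  have := Finset.sum_le_sum fun a (_ : a ∈ Finset.univ) => key a
  rw [Finset.sum_sub_distrib, Finset.sum_sub_distrib] at this
  linarith

/-- The points that display the word `w` in the window `[1, 1 + n)`. -/
def fullCyl {n : ℕ} (w : Fin n → Fin d) : Set (ℤ → Fin d) :=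
  Set.preimage (fun x => word x 1 n) {w}

/-- The entropy of the distribution of the words displayed in `[1, 1 + n)`. -/
noncomputable def wordEntropy (ν : Measure (ℤ → Fin d)) (n : ℕ) : ℝ :=
  ∑ w : Fin n → Fin d, Real.negMulLog (ν.real (fullCyl w))

theorem measurable_word (a : ℤ) (n : ℕ) : Measurable fun x : ℤ → Fin d => word x a n := by
  unfold word
  fun_prop

theorem localOn_fullCyl {n : ℕ} (w : Fin n → Fin d) : LocalOn (fullCyl w) 1 (1 + n) := by
  intro x y hxy hx
  rw [← word_eq_iff] at hxy
  exact hxy.symm.trans hx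

theorem sum_fullCyl_mul (ν : Measure (ℤ → Fin d)) [IsProbabilityMeasure ν] {n : ℕ}
    (φ : (Fin n → Fin d) → ℝ) :
    ∑ w, ν.real (fullCyl w) * φ w = ∫ x, φ (word x 1 n) ∂ν := by
  have hm := measurable_word (d := d) 1 n
  rw [← integral_map (φ := fun x => word x 1 n) hm.aemeasurable
    (measurable_of_finite φ).aestronglyMeasurable]
  have : IsProbabilityMeasure (ν.map fun x => word x 1 n) :=
    Measure.isProbabilityMeasure_map hm.aemeasurable
  rw [integral_fintype (Integrable.of_finite)]
  refine Finset.sum_congr rfl fun w _ => ?_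
  rw [map_measureReal_apply hm (measurableSet_singleton w), smul_eq_mul]
  rfl

theorem sum_fullCyl (ν : Measure (ℤ → Fin d)) [IsProbabilityMeasure ν] (n : ℕ) :
    ∑ w : Fin n → Fin d, ν.real (fullCyl w) = 1 := by
  have := sum_fullCyl_mul ν (n := n) fun _ => 1
  simpa using this

theorem wordEntropy_nonneg (ν : Measure (ℤ → Fin d)) [IsProbabilityMeasure ν] (n : ℕ) :
    0 ≤ wordEntropy ν n :=
  Finset.sum_nonneg fun _ _ => Real.negMulLog_nonneg measureReal_nonneg measureReal_le_one

/-- Gibbs' inequality compares the distribution of a word with the product of the distributions of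
its two parts; invariance identifies the second part with a word at position `1`. -/
theorem subadditive_wordEntropy {ν : Measure (ℤ → Fin d)} [IsProbabilityMeasure ν]
    (hinv : MeasurePreserving (shift 1) ν ν) : Subadditive (wordEntropy ν) := by
  intro n m
  let q₁ : (Fin (n + m) → Fin d) → ℝ := fun w => ν.real (fullCyl fun i => w (Fin.castAdd m i))
  let q₂ : (Fin (n + m) → Fin d) → ℝ := fun w => ν.real (fullCyl fun i => w (Fin.natAdd n i))
  have hmp := measurePreserving_shift_nat hinv n
  have hshift : ∀ x : ℤ → Fin d, (fun i => word x 1 (n + m) (Fin.natAdd n i)) =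
      word (shift (n : ℤ) x) 1 m := by
    intro x
    funext i
    simp only [word, shift_apply, Fin.val_natAdd]
    congr 1
    push_cast
    ring
  have le₁ : ∀ w, ν.real (fullCyl w) ≤ q₁ w := fun w =>
    measureReal_mono (by rintro x rfl; rfl)
  have le₂ : ∀ w, ν.real (fullCyl w) ≤ q₂ w := fun w => by
    refine (measureReal_mono ?_).trans_eq
      (hmp.measureReal_preimage (localOn_fullCyl _).measurableSet.nullMeasurableSet)
    rintro x rfl
    exact (hshift x).symm
  have hsum : ∑ w, q₁ w * q₂ w = 1 := by
    rw [← (Fin.appendEquiv (α := Fin d) n m).sum_comp, Fintype.sum_prod_type]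
    simp only [q₁, q₂, Fin.appendEquiv, Equiv.coe_fn_mk, Fin.append_left, Fin.append_right]
    simp only [← Finset.mul_sum, sum_fullCyl, mul_one]
  have h1 := sum_negMulLog_le (p := fun w : Fin (n + m) → Fin d => ν.real (fullCyl w))
    (q := fun w => q₁ w * q₂ w) (fun _ => measureReal_nonneg)
    (fun _ => mul_nonneg measureReal_nonneg measureReal_nonneg) ?_ (by rw [hsum, sum_fullCyl])
  · refine h1.trans (le_of_eq ?_)
    have e1 : ∀ w : Fin (n + m) → Fin d, ν.real (fullCyl w) * -Real.log (q₁ w * q₂ w) =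
        ν.real (fullCyl w) * -Real.log (q₁ w) + ν.real (fullCyl w) * -Real.log (q₂ w) := by
      intro w
      rcases eq_or_lt_of_le (measureReal_nonneg (μ := ν) (s := fullCyl w)) with h0 | h0
      · rw [← h0]; ring
      · rw [Real.log_mul (h0.trans_le (le₁ w)).ne' (h0.trans_le (le₂ w)).ne']
        ring
    rw [Finset.sum_congr rfl fun w _ => e1 w, Finset.sum_add_distrib, sum_fullCyl_mul,
      sum_fullCyl_mul]
    unfold wordEntropy
    congr 1
    · refine (sum_fullCyl_mul ν fun u : Fin n → Fin d =>
        -Real.log (ν.real (fullCyl u))).symm.trans ?_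
      exact Finset.sum_congr rfl fun u _ => by rw [Real.negMulLog]; ring
    · simp only [q₂, hshift]
      have hmeas : Measurable fun x : ℤ → Fin d => -Real.log (ν.real (fullCyl (word x 1 m))) :=
        (measurable_of_finite fun u : Fin m → Fin d => -Real.log (ν.real (fullCyl u))).comp
          (measurable_word 1 m)
      have hint := integral_map (μ := ν) (φ := shift (n : ℤ)) hmp.measurable.aemeasurable
        (f := fun x : ℤ → Fin d => -Real.log (ν.real (fullCyl (word x 1 m))))
        hmeas.aestronglyMeasurable
      rw [hmp.map_eq] at hint
      rw [← hint, ← sum_fullCyl_mul ν fun u : Fin m → Fin d => -Real.log (ν.real (fullCyl u))]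
      exact Finset.sum_congr rfl fun u _ => by rw [Real.negMulLog]; ring
  · intro w hw
    have h0 : 0 < ν.real (fullCyl w) := lt_of_le_of_ne measureReal_nonneg (Ne.symm hw)
    exact ne_of_gt (mul_pos (h0.trans_le (le₁ w)) (h0.trans_le (le₂ w)))

/-- The entropy of a distribution on free words that gives a prescribed mass to a local set. -/
theorem wordEntropy_le_of_local {ν : Measure (ℤ → Fin d)} [IsProbabilityMeasure ν] {n : ℕ}
    (hfree : ν (freeSet d ℓ 1 (1 + n))ᶜ = 0) {U : Set (ℤ → Fin d)} (hU : LocalOn U 1 (1 + n))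
    (hf : 0 < freeCount d ℓ n) (hD : 0 < cnt (U ∩ freeSet d ℓ 1 (1 + n)) 1 n) :
    wordEntropy ν n ≤ Real.log 2 +
      ν.real U * Real.log (cnt (U ∩ freeSet d ℓ 1 (1 + n)) 1 n) +
      (1 - ν.real U) * Real.log (freeCount d ℓ n) := by
  classical
  have hfin : ∀ S : Set (ℤ → Fin d), ((fun x => word x 1 n) '' S).Finite := fun _ => Set.toFinite _
  let D := (hfin (U ∩ freeSet d ℓ 1 (1 + n))).toFinset
  let F := (hfin (freeSet d ℓ 1 (1 + n))).toFinset
  have hDc : D.card = cnt (U ∩ freeSet d ℓ 1 (1 + n)) 1 n :=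
    (Set.ncard_eq_toFinset_card _ (hfin _)).symm
  have hFc : F.card = freeCount d ℓ n := by
    rw [← cnt_freeSet 1 n]
    exact (Set.ncard_eq_toFinset_card _ (hfin _)).symm
  rw [← hDc] at hD
  rw [← hFc] at hf
  rw [← hDc, ← hFc]
  have hD' : (0 : ℝ) < D.card := by exact_mod_cast hD
  have hF' : (0 : ℝ) < F.card := by exact_mod_cast hf
  -- Reference weights for Gibbs' inequality: half of the mass is spread over the words of `U`, and
  -- at most half over the other free words. The halves produce the term `log 2`.
  let q : (Fin n → Fin d) → ℝ := fun w =>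
    (if w ∈ D then (2 * (D.card : ℝ))⁻¹ else 0) + (if w ∈ F \ D then (2 * (F.card : ℝ))⁻¹ else 0)
  have hp0 : ∀ w, w ∉ F → ν.real (fullCyl w) = 0 := by
    intro w hw
    have : fullCyl w ⊆ (freeSet d ℓ 1 (1 + n))ᶜ := by
      intro x hx hxf
      exact hw ((Set.Finite.mem_toFinset _).2 ⟨x, hxf, hx⟩)
    exact (measureReal_eq_zero_iff).2 (measure_mono_null this hfree)
  have hDF : D ⊆ F := by
    intro w hw
    obtain ⟨x, hx, hxw⟩ := (Set.Finite.mem_toFinset _).1 hw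
    exact (Set.Finite.mem_toFinset _).2 ⟨x, hx.2, hxw⟩
  have hq : ∑ w, q w ≤ 1 := by
    simp only [q]
    rw [Finset.sum_add_distrib, Finset.sum_ite_mem, Finset.sum_ite_mem, Finset.univ_inter,
      Finset.univ_inter, Finset.sum_const, Finset.sum_const, nsmul_eq_mul, nsmul_eq_mul]
    have h1 : (D.card : ℝ) * (2 * (D.card : ℝ))⁻¹ = 1 / 2 := by field_simp
    have h2 : ((F \ D).card : ℝ) * (2 * (F.card : ℝ))⁻¹ ≤ F.card * (2 * (F.card : ℝ))⁻¹ := by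
      gcongr
      exact Finset.sdiff_subset
    have h3 : (F.card : ℝ) * (2 * (F.card : ℝ))⁻¹ = 1 / 2 := by field_simp
    linarith
  have h1 := sum_negMulLog_le (p := fun w : Fin n → Fin d => ν.real (fullCyl w)) (q := q)
    (fun _ => measureReal_nonneg) (fun w => by positivity) ?_ (by rw [sum_fullCyl]; exact hq)
  · refine h1.trans ?_
    have e : ∀ w : Fin n → Fin d, ν.real (fullCyl w) * -Real.log (q w) =
        (if w ∈ D then ν.real (fullCyl w) else 0) *
          (Real.log D.card - Real.log F.card) +
        ν.real (fullCyl w) * (Real.log 2 + Real.log F.card) := by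
      intro w
      by_cases hwD : w ∈ D
      · have : q w = (2 * (D.card : ℝ))⁻¹ := by simp [q, hwD]
        rw [this, if_pos hwD, Real.log_inv, Real.log_mul (by norm_num) hD'.ne']
        ring
      · by_cases hwF : w ∈ F
        · have : q w = (2 * (F.card : ℝ))⁻¹ := by simp [q, hwD, hwF]
          rw [this, if_neg hwD, Real.log_inv, Real.log_mul (by norm_num) hF'.ne']
          ring
        · rw [if_neg hwD, hp0 w hwF]
          ring
    have hDU : ∑ w ∈ D, ν.real (fullCyl w) = ν.real U := by
      have := sum_measureReal_preimage_singleton (μ := ν) D (f := fun x => word x 1 n)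
        (fun w _ => (localOn_fullCyl w).measurableSet)
      unfold fullCyl
      rw [this]
      have hset : (fun x => word x 1 n) ⁻¹' (D : Set (Fin n → Fin d)) =
          U ∩ freeSet d ℓ 1 (1 + n) := by
        ext x
        simp only [D, Set.Finite.coe_toFinset, Set.mem_preimage]
        constructor
        · rintro ⟨y, hy, hyx⟩
          rw [word_eq_iff] at hyx
          exact ⟨hU hyx hy.1, localOn_freeSet _ _ _ hyx hy.2⟩
        · exact fun hx => ⟨x, hx, rfl⟩
      rw [hset]
      refine measureReal_congr ?_
      have : freeSet d ℓ 1 (1 + n) =ᵐ[ν] Set.univ := ae_eq_univ.2 hfree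
      simpa using (ae_eq_refl U).inter this
    rw [Finset.sum_congr rfl fun w _ => e w, Finset.sum_add_distrib, ← Finset.sum_mul,
      ← Finset.sum_mul, Finset.sum_ite_mem, Finset.univ_inter, hDU, sum_fullCyl]
    linarith
  · intro w hw
    have hwF : w ∈ F := by
      by_contra hcon
      exact hw (hp0 w hcon)
    by_cases hwD : w ∈ D
    · have : q w = (2 * (D.card : ℝ))⁻¹ := by simp [q, hwD]
      rw [this]
      positivity
    · have : q w = (2 * (F.card : ℝ))⁻¹ := by simp [q, hwD, hwF]
      rw [this]
      positivity

theorem wordEntropy_le {ν : Measure (ℤ → Fin d)} [IsProbabilityMeasure ν] {n : ℕ}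
    (hfree : ν (freeSet d ℓ 1 (1 + n))ᶜ = 0) (hf : 0 < freeCount d ℓ n) :
    wordEntropy ν n ≤ Real.log 2 + Real.log (freeCount d ℓ n) := by
  have h := wordEntropy_le_of_local hfree (localOn_univ _ _) hf
  rw [Set.univ_inter, cnt_freeSet, probReal_univ] at h
  have := h hf
  linarith

/-- Every word has mass at most `81 / κ ^ n`, so its information content is at least `n * log κ -
log 81`. -/
theorem IsGibbs.le_wordEntropy {κ : ℝ} (hκ0 : 0 < κ) {μ : Measure (ℤ → Fin d)}
    (h : IsGibbs ℓ κ μ) (n : ℕ) : n * Real.log κ - Real.log 81 ≤ wordEntropy μ n := by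
  have := h.prob
  have hle : ∀ w : Fin n → Fin d, μ.real (fullCyl w) ≤ 81 / κ ^ n := by
    intro w
    refine (h.le _ 1 n (localOn_fullCyl w)).trans ?_
    have hc : cnt (fullCyl w ∩ freeSet d ℓ 1 (1 + n)) 1 n ≤ 1 := by
      unfold cnt
      refine (Set.ncard_le_ncard (t := {w}) ?_).trans (by simp)
      rintro _ ⟨x, hx, rfl⟩
      exact hx.1
    rw [← mul_div_assoc]
    gcongr
    have : ((cnt (fullCyl w ∩ freeSet d ℓ 1 (1 + n)) 1 n : ℕ) : ℝ) ≤ 1 := by exact_mod_cast hc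
    linarith
  have hterm : ∀ w : Fin n → Fin d,
      μ.real (fullCyl w) * (n * Real.log κ - Real.log 81) ≤
        Real.negMulLog (μ.real (fullCyl w)) := by
    intro w
    rcases eq_or_lt_of_le (measureReal_nonneg (μ := μ) (s := fullCyl w)) with h0 | h0
    · rw [← h0]; simp
    · have := Real.log_le_log h0 (hle w)
      rw [Real.log_div (by norm_num) (by positivity), Real.log_pow] at this
      rw [Real.negMulLog]
      nlinarith
  have := Finset.sum_le_sum fun w (_ : w ∈ Finset.univ) => hterm w
  rwa [← Finset.sum_mul, sum_fullCyl, one_mul] at this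

/-- If `ν(E) > 0 = μ(E)`, some local `U` carries at least half of `ν(E)` but has tiny `μ`-measure,
hence tiny density. Then a fixed proportion of `ν` lives on very few words, which pushes its entropy
on a finite window below `n * log κ`. -/
theorem IsGibbs.absolutelyContinuous {κ : ℝ} (hκ0 : 0 < κ)
    (hf : ∀ n, κ ^ n ≤ freeCount d ℓ n ∧ (freeCount d ℓ n : ℝ) ≤ 9 * κ ^ n)
    {μ : Measure (ℤ → Fin d)} (h : IsGibbs ℓ κ μ) {ν : Measure (ℤ → Fin d)}
    [IsProbabilityMeasure ν] (hinv : MeasurePreserving (shift 1) ν ν)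
    (hfree : ∀ n : ℕ, ν (freeSet d ℓ 1 (1 + n))ᶜ = 0)
    (hH : ∀ n : ℕ, n * Real.log κ ≤ wordEntropy ν n) : ν ≪ μ := by
  have := h.prob
  refine Measure.AbsolutelyContinuous.mk fun E hE hμE => ?_
  by_contra hνE
  have hμE' : μ.real E = 0 := (measureReal_eq_zero_iff).2 hμE
  set t := ν.real E with ht
  have ht0 : 0 < t :=
    lt_of_le_of_ne measureReal_nonneg (fun e => hνE ((measureReal_eq_zero_iff).1 e.symm))
  have ht1 : t ≤ 1 := measureReal_le_one
  -- The entropy bound gives `p * log density ≥ -log 18` with `p = ν(U) ≥ t / 2`, where `18 = 2 *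
  -- 9`; so the density is at least `c`. The choices of `ε` and `s` below keep each term of
  -- `density_le` at or below `c / 4`.
  set c : ℝ := Real.exp (-(2 * Real.log 18 / t)) with hc
  have hc0 : 0 < c := Real.exp_pos _
  set ε : ℝ := min (t / 2) (c / (4 * 7776)) with hε
  have hε0 : 0 < ε := by positivity
  have hε1 : ε ≤ t / 2 := min_le_left _ _
  have hε2 : ε ≤ c / (4 * 7776) := min_le_right _ _
  obtain ⟨U, r, hU, hlt⟩ := exists_local_symmDiff_lt (μ + ν) hE hε0
  rw [measureReal_add_apply] at hlt
  have n1 := measureReal_nonneg (μ := μ) (s := symmDiff E U)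
  have n2 := measureReal_nonneg (μ := ν) (s := symmDiff E U)
  have hμU : μ.real U ≤ ε := by
    have h1 : μ.real U ≤ μ.real E + μ.real (symmDiff E U) :=
      (measureReal_mono (by
        intro x hx
        by_cases hxE : x ∈ E
        · exact Or.inl hxE
        · exact Or.inr (Or.inr ⟨hx, hxE⟩))).trans (measureReal_union_le _ _)
    linarith
  have hνU : t / 2 ≤ ν.real U := by
    have h1 : ν.real E ≤ ν.real U + ν.real (symmDiff E U) :=
      (measureReal_mono (by
        intro x hx
        by_cases hxU : x ∈ U
        · exact Or.inl hxU
        · exact Or.inr (Or.inl ⟨hx, hxU⟩))).trans (measureReal_union_le _ _)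
    linarith
  obtain ⟨s, hs⟩ := exists_pow_lt_of_lt_one (y := (1 / 2 : ℝ))
    (show 0 < c / (4 * 3888) by positivity) (by norm_num)
  have hdens := h.density_le hκ0 (fun n => (hf n).1) hU s
  have hsmall : density ℓ κ U r s < c := by
    rw [lt_div_iff₀ (by norm_num)] at hs
    rw [le_div_iff₀ (by norm_num)] at hε2
    nlinarith
  -- The entropy bound forces the density to be at least `c`.
  set n : ℕ := 2 * r + 4 * s + 4 * s with hn
  -- Moves the window `[-r - 4 * s, r + 4 * s)` onto `[1, 1 + n)`, where `wordEntropy` is measured.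
  let k : ℕ := 1 + r + 4 * s
  have hk : k = 1 + r + 4 * s := rfl
  set U' : Set (ℤ → Fin d) := shift (k : ℤ) ⁻¹' U with hU'
  have hU'l : LocalOn U' 1 (1 + n) := (hU.shift_preimage k).mono (by omega) (by omega)
  have hνU' : ν.real U' = ν.real U :=
    (measurePreserving_shift_nat hinv k).measureReal_preimage hU.measurableSet.nullMeasurableSet
  have hfpos : (0 : ℝ) < freeCount d ℓ n := lt_of_lt_of_le (by positivity) (hf n).1
  have hcnt : cnt (U' ∩ freeSet d ℓ 1 (1 + n)) 1 n =
      cnt (U ∩ freeSet d ℓ (-r - 4 * s) (r + 4 * s)) (-r - 4 * s) n := by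
    rw [← cnt_shift_preimage (U ∩ freeSet d ℓ (-r - 4 * s) (r + 4 * s)) k, Set.preimage_inter,
      shift_preimage_freeSet]
    congr 1
    · congr 2 <;> omega
    · omega
  have hDpos : 0 < cnt (U' ∩ freeSet d ℓ 1 (1 + n)) 1 n := by
    refine cnt_pos ?_ _ _
    by_contra hemp
    rw [Set.not_nonempty_iff_eq_empty] at hemp
    have hsub : U' ⊆ (freeSet d ℓ 1 (1 + n))ᶜ := fun x hx hx' => by
      have : x ∈ (∅ : Set (ℤ → Fin d)) := hemp ▸ ⟨hx, hx'⟩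
      exact this
    have h0 : ν.real U' = 0 := (measureReal_eq_zero_iff).2 (measure_mono_null hsub (hfree n))
    linarith
  have hent := (hH n).trans
    (wordEntropy_le_of_local (hfree n) hU'l (by exact_mod_cast hfpos) hDpos)
  have hD' : (0 : ℝ) < cnt (U' ∩ freeSet d ℓ 1 (1 + n)) 1 n := by exact_mod_cast hDpos
  have hdeq : (cnt (U' ∩ freeSet d ℓ 1 (1 + n)) 1 n : ℝ) = density ℓ κ U r s * κ ^ n := by
    rw [hcnt, density, div_mul_cancel₀ _ (by positivity)]
  have hdpos : 0 < density ℓ κ U r s := by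
    rw [hdeq] at hD'
    exact pos_of_mul_pos_left hD' (by positivity)
  rw [hdeq, Real.log_mul hdpos.ne' (by positivity), Real.log_pow, hνU'] at hent
  have hlogf : Real.log (freeCount d ℓ n) ≤ Real.log 9 + n * Real.log κ := by
    have := Real.log_le_log hfpos (hf n).2
    rwa [Real.log_mul (by norm_num) (by positivity), Real.log_pow] at this
  set p := ν.real U with hp
  have hp1 : p ≤ 1 := measureReal_le_one
  have hlog18 : Real.log 18 = Real.log 2 + Real.log 9 := by
    rw [← Real.log_mul (by norm_num) (by norm_num)]; norm_num
  have h9 : 0 ≤ Real.log 9 := Real.log_nonneg (by norm_num)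
  have h18 : 0 ≤ Real.log 18 := Real.log_nonneg (by norm_num)
  have hmain : -Real.log 18 ≤ p * Real.log (density ℓ κ U r s) := by
    have h1 := mul_le_mul_of_nonneg_left hlogf (sub_nonneg.2 hp1)
    have h2 : 0 ≤ p * Real.log 9 := mul_nonneg (by linarith) h9
    linarith
  have hcle : c ≤ density ℓ κ U r s := by
    rw [hc, ← Real.le_log_iff_exp_le hdpos]
    have hppos : 0 < p := by linarith
    have h1 : -(Real.log 18 / p) ≤ Real.log (density ℓ κ U r s) := by
      rw [← neg_div, div_le_iff₀ hppos]
      linarith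
    refine le_trans ?_ h1
    rw [neg_le_neg_iff, div_le_div_iff₀ hppos ht0]
    nlinarith
  linarith

end Entropy

/-! ### Passing between the shift space and the full shift -/

section Transfer

variable {d : ℕ} {ℓ : ℕ → ℕ} (X : Subshift (Fin d) ℤ)

/-- A measure on `X`, viewed as a measure on the full shift. -/
noncomputable def pushforward (ν : ProbabilityMeasure X.carrier) : Measure (ℤ → Fin d) :=
  (ν : Measure X.carrier).map Subtype.val

instance (ν : ProbabilityMeasure X.carrier) : IsProbabilityMeasure (pushforward X ν) :=
  Measure.isProbabilityMeasure_map measurable_subtype_coe.aemeasurable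

theorem measurableEmbedding_val :
    MeasurableEmbedding (Subtype.val : X.carrier → ℤ → Fin d) :=
  MeasurableEmbedding.subtype_coe X.isClosed.measurableSet

theorem pushforward_injective : Function.Injective (pushforward X) := by
  intro ν ν' h
  apply Subtype.ext
  have := congrArg (Measure.comap (Subtype.val : X.carrier → ℤ → Fin d)) h
  rwa [pushforward, pushforward, (measurableEmbedding_val X).comap_map,
    (measurableEmbedding_val X).comap_map] at this

theorem val_comp_shiftMap :
    (Subtype.val : X.carrier → ℤ → Fin d) ∘ shiftMap X = shift 1 ∘ Subtype.val := rfl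

theorem measurable_shiftMap : Measurable (shiftMap X) :=
  (measurableEmbedding_val X).measurable_comp_iff.1
    ((measurable_shift 1).comp measurable_subtype_coe)

theorem mem_invariantMeasures_iff {ν : ProbabilityMeasure X.carrier} :
    ν ∈ invariantMeasures X ↔
      MeasurePreserving (shift 1) (pushforward X ν) (pushforward X ν) := by
  have h1 : (pushforward X ν).map (shift 1) =
      ((ν : Measure X.carrier).map (shiftMap X)).map Subtype.val := by
    rw [pushforward, Measure.map_map (measurable_shift 1) measurable_subtype_coe,
      Measure.map_map measurable_subtype_coe (measurable_shiftMap X), val_comp_shiftMap]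
  constructor
  · intro h
    exact ⟨measurable_shift 1, by rw [h1, (show MeasurePreserving _ _ _ from h).map_eq]; rfl⟩
  · intro h
    refine ⟨measurable_shiftMap X, ?_⟩
    have h2 := h.map_eq
    rw [h1] at h2
    have := congrArg (Measure.comap (Subtype.val : X.carrier → ℤ → Fin d)) h2
    rwa [pushforward, (measurableEmbedding_val X).comap_map,
      (measurableEmbedding_val X).comap_map] at this

theorem blockEntropy_eq (ν : ProbabilityMeasure X.carrier) (n : ℕ) :
    blockEntropy X ν n = wordEntropy (pushforward X ν) n := by
  have hcyl : ∀ w : Fin n → Fin d,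
      (pushforward X ν).real (fullCyl w) = (ν : Measure X.carrier).real (cyl X w) := fun w => by
    rw [pushforward, map_measureReal_apply measurable_subtype_coe (localOn_fullCyl w).measurableSet]
    rfl
  unfold blockEntropy wordEntropy
  simp only [hcyl]
  refine Finset.sum_subset (Finset.subset_univ _) fun w _ hw => ?_
  have : cyl X w = ∅ := by
    refine Set.eq_empty_of_forall_notMem fun x hx => hw ?_
    exact (Set.Finite.mem_toFinset _).2 ⟨x.1, x.2, 1, hx⟩
  simp [this]

/-- By Fekete's lemma the limit is also an infimum over positive lengths. The resulting bound at
every finite `n` has no error term, as `IsGibbs.absolutelyContinuous` requires. -/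
theorem tendsto_entropy {ν : ProbabilityMeasure X.carrier} (hν : ν ∈ invariantMeasures X) :
    Tendsto (fun n : ℕ => wordEntropy (pushforward X ν) n / n) atTop (nhds (entropy X ν)) ∧
      ∀ n : ℕ, n * entropy X ν ≤ wordEntropy (pushforward X ν) n := by
  have hsub := subadditive_wordEntropy ((mem_invariantMeasures_iff X).1 hν)
  have hbdd : BddBelow (Set.range fun n : ℕ => wordEntropy (pushforward X ν) n / n) :=
    ⟨0, by rintro _ ⟨n, rfl⟩; exact div_nonneg (wordEntropy_nonneg _ n) (Nat.cast_nonneg _)⟩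
  have hlim := hsub.tendsto_lim hbdd
  have hent : entropy X ν = hsub.lim := by
    unfold entropy
    simp only [blockEntropy_eq]
    exact hlim.limUnder_eq
  refine ⟨hent ▸ hlim, fun n => ?_⟩
  rcases Nat.eq_zero_or_pos n with rfl | hn
  · simpa using wordEntropy_nonneg (pushforward X ν) 0
  · have := hsub.lim_le_div hbdd hn.ne'
    rw [le_div_iff₀ (by exact_mod_cast hn)] at this
    rw [hent]
    linarith

variable {X}

theorem pushforward_compl_freeSet (hX : ∀ x, x ∈ X.carrier ↔ ∀ a b, FreeOn ℓ x a b)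
    (ν : ProbabilityMeasure X.carrier) (a b : ℤ) : pushforward X ν (freeSet d ℓ a b)ᶜ = 0 := by
  rw [pushforward, Measure.map_apply measurable_subtype_coe
    (localOn_freeSet ℓ a b).compl.measurableSet]
  have : (Subtype.val : X.carrier → ℤ → Fin d) ⁻¹' (freeSet d ℓ a b)ᶜ = ∅ :=
    Set.eq_empty_of_forall_notMem fun x hx => hx ((hX x.1).1 x.2 a b)
  rw [this, measure_empty]

theorem entropy_le_log {κ : ℝ} (hκ0 : 0 < κ)
    (hf : ∀ n, κ ^ n ≤ freeCount d ℓ n ∧ (freeCount d ℓ n : ℝ) ≤ 9 * κ ^ n)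
    (hX : ∀ x, x ∈ X.carrier ↔ ∀ a b, FreeOn ℓ x a b) {ν : ProbabilityMeasure X.carrier}
    (hν : ν ∈ invariantMeasures X) : entropy X ν ≤ Real.log κ := by
  have t1 := (tendsto_entropy X hν).1
  have t2 := (tendsto_const_div_atTop_nhds_zero_nat (Real.log 2 + Real.log 9)).add_const
    (Real.log κ)
  rw [zero_add] at t2
  refine le_of_tendsto_of_tendsto t1 t2 ?_
  filter_upwards [eventually_gt_atTop 0] with n hn
  have hn' : (0 : ℝ) < n := by exact_mod_cast hn
  have hfpos : (0 : ℝ) < freeCount d ℓ n := lt_of_lt_of_le (by positivity) (hf n).1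
  have h1 := wordEntropy_le (pushforward_compl_freeSet hX ν 1 (1 + n)) (by exact_mod_cast hfpos)
  have h2 := Real.log_le_log hfpos (hf n).2
  rw [Real.log_mul (by norm_num) (by positivity), Real.log_pow] at h2
  rw [div_add' _ _ _ hn'.ne']
  gcongr
  linarith

/-- The complement of `X` is a countable union of events that a central window is not free, and the
upper Gibbs bound makes each of them null. -/
theorem exists_pushforward_eq (hX : ∀ x, x ∈ X.carrier ↔ ∀ a b, FreeOn ℓ x a b) {κ : ℝ}
    {μ : Measure (ℤ → Fin d)} (h : IsGibbs ℓ κ μ) :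
    ∃ ν : ProbabilityMeasure X.carrier, pushforward X ν = μ := by
  have := h.prob
  have hnull : μ X.carrierᶜ = 0 := by
    refine measure_mono_null (t := ⋃ r : ℕ, (freeSet d ℓ (-r) r)ᶜ) ?_
      (measure_iUnion_null h.measure_compl_freeSet)
    intro x hx
    by_contra hcon
    simp only [Set.mem_iUnion, Set.mem_compl_iff, not_exists, not_not] at hcon
    refine hx ((hX x).2 fun a b => ?_)
    exact (hcon (a.natAbs + b.natAbs)).mono (by omega) (by omega)
  have hmap : (μ.comap (Subtype.val : X.carrier → ℤ → Fin d)).map Subtype.val = μ := by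
    rw [(measurableEmbedding_val X).map_comap, Subtype.range_val]
    exact Measure.restrict_eq_self_of_ae_mem hnull
  have hprob : IsProbabilityMeasure (μ.comap (Subtype.val : X.carrier → ℤ → Fin d)) := by
    constructor
    rw [← Set.preimage_univ (f := (Subtype.val : X.carrier → ℤ → Fin d)),
      ← Measure.map_apply measurable_subtype_coe MeasurableSet.univ, hmap, measure_univ]
  exact ⟨⟨_, hprob⟩, hmap⟩

/-- A shift space defined by forbidding periodic words of exponent at least `12` has exactly one
measure of maximal entropy. -/
theorem existsUnique_isMME (hd : 2 ≤ d) (hℓ : ∀ m, 0 < m → 12 * m ≤ ℓ m)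
    (hX : ∀ x, x ∈ X.carrier ↔ ∀ a b, FreeOn ℓ x a b) :
    ∃! μ : ProbabilityMeasure X.carrier, IsMME X μ := by
  have hd' : (2 : ℝ) ≤ d := by exact_mod_cast hd
  obtain ⟨κ, hκ, hf⟩ := exists_growth_rate hd hℓ
  have hκ0 : 0 < κ := by linarith
  obtain ⟨m, hm⟩ := exists_isGibbs hd hℓ hκ hf
  obtain ⟨μ, hμ⟩ := exists_pushforward_eq hX hm
  have hμinv : μ ∈ invariantMeasures X := by
    rw [mem_invariantMeasures_iff, hμ]
    exact hm.invariant
  have hμent : Real.log κ ≤ entropy X μ := by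
    have t1 := (tendsto_entropy X hμinv).1
    have t2 := (tendsto_const_div_atTop_nhds_zero_nat (Real.log 81)).const_sub (Real.log κ)
    rw [sub_zero] at t2
    refine le_of_tendsto_of_tendsto t2 t1 ?_
    filter_upwards [eventually_gt_atTop 0] with n hn
    have hn' : (0 : ℝ) < n := by exact_mod_cast hn
    have h1 := hm.le_wordEntropy hκ0 n
    rw [hμ, sub_div' hn'.ne']
    gcongr
    linarith
  refine ⟨μ, ⟨hμinv, fun ν hν => (entropy_le_log hκ0 hf hX hν).trans hμent⟩, ?_⟩
  rintro ν ⟨hν, hmax⟩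
  apply pushforward_injective X
  have hνinv := (mem_invariantMeasures_iff X).1 hν
  rw [hμ]
  have := hm.prob
  -- A maximal `ν` has entropy at least `log κ`, hence is absolutely continuous; an invariant
  -- probability measure absolutely continuous with respect to an ergodic one equals it.
  refine hm.ergodic.eq_of_absolutelyContinuous hνinv
    (hm.absolutelyContinuous hκ0 hf hνinv (fun n => pushforward_compl_freeSet hX ν _ _) fun n => ?_)
  refine le_trans ?_ ((tendsto_entropy X hν).2 n)
  exact mul_le_mul_of_nonneg_left (hμent.trans (hmax μ hμinv)) (Nat.cast_nonneg _)

end Transfer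

/-! ### Powers as periodic words of a minimal length -/

section Powers

variable {d : ℕ}

theorem HasPeriodOn.apply_mod {x : ℤ → Fin d} {m n : ℕ} {i : ℤ} (h : HasPeriodOn x m i (i + n))
    (k : ℕ) (hk : k < n) : x (i + k) = x (i + (k % m : ℕ)) := by
  induction k using Nat.strong_induction_on with
  | _ k ih =>
    by_cases hkm : k < m
    · rw [Nat.mod_eq_of_lt hkm]
    rcases Nat.eq_zero_or_pos m with rfl | hm
    · simp
    have h1 := ih (k - m) (by omega) (by omega)
    rw [← Nat.mod_eq_sub_mod (by omega)] at h1
    rw [← h1, h (i + (k - m : ℕ)) (by omega) (by omega)]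
    congr 1
    omega

/-- The exponent is forced to be `n / m`, which is rational, so only the period and the length
matter. -/
theorem word_mem_powers_iff {S : Set ℝ} {x : ℤ → Fin d} {i : ℤ} {n : ℕ} :
    word x i n ∈ powers d S n ↔
      ∃ m : ℕ, 0 < m ∧ (n : ℝ) / m ∈ S ∧ HasPeriodOn x m i (i + n) := by
  constructor
  · rintro ⟨m, hm, v, α, hα, hn, hw⟩
    have hm' : (m : ℚ) ≠ 0 := by exact_mod_cast hm.ne'
    refine ⟨m, hm, ?_, ?_⟩
    · have : α = (n : ℚ) / m := by rw [eq_div_iff hm', hn]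
      rw [this] at hα
      push_cast at hα
      exact hα
    · intro j hj hj'
      have h1 := congrFun hw ⟨(j - i).toNat, by omega⟩
      have h2 := congrFun hw ⟨(j - i).toNat + m, by omega⟩
      simp only [word, periodicWord, Nat.add_mod_right] at h1 h2
      rw [← h1] at h2
      rw [show i + ((j - i).toNat : ℤ) = j by omega] at h2
      rw [show i + (((j - i).toNat + m : ℕ) : ℤ) = j + m by omega] at h2
      exact h2.symm
  · rintro ⟨m, hm, hS, hp⟩
    have hm' : (m : ℚ) ≠ 0 := by exact_mod_cast hm.ne'
    refine ⟨m, hm, word x i m, (n : ℚ) / m, by push_cast; exact hS, div_mul_cancel₀ _ hm', ?_⟩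
    funext k
    exact hp.apply_mod k k.2

/-- A longer word of period `m` has a prefix of length `ℓ m` with the same period, so forbidding the
minimal length suffices. -/
theorem mem_shiftSpace_powers_iff {S : Set ℝ} {ℓ : ℕ → ℕ}
    (h : ∀ m n : ℕ, 0 < m → ((n : ℝ) / m ∈ S ↔ ℓ m ≤ n)) (x : ℤ → Fin d) :
    x ∈ (shiftSpace (powers d S)).carrier ↔ ∀ a b, FreeOn ℓ x a b := by
  constructor
  · intro hx a b m hm s _ _ hp
    exact hx s (ℓ m) (word_mem_powers_iff.2 ⟨m, hm, (h m _ hm).2 le_rfl, hp⟩)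
  · intro hx i n hmem
    obtain ⟨m, hm, hS, hp⟩ := word_mem_powers_iff.1 hmem
    have hle := (h m n hm).1 hS
    exact hx i (i + n) m hm i le_rfl (by omega) (hp.mono le_rfl (by omega))

end Powers

end PowerFree

theorem theorem1p1 (d : ℕ) (hd : 2 ≤ d) (β : ℝ) :
    ((12 < β ∨ (3 ≤ d ∧ β = 12)) →
      ∃! μ : ProbabilityMeasure (PowerFree.freeShift d β).carrier,
        PowerFree.IsMME (PowerFree.freeShift d β) μ) ∧
    (12 ≤ β →
      ∃! μ : ProbabilityMeasure (PowerFree.freeShiftPlus d β).carrier,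
        PowerFree.IsMME (PowerFree.freeShiftPlus d β) μ) := by
  constructor
  · intro h
    have hβ : 12 ≤ β := h.elim le_of_lt fun h => h.2.ge
    -- The least `n` with `n / m ≥ β`.
    refine PowerFree.existsUnique_isMME (ℓ := fun m => ⌈β * m⌉₊) hd (fun m hm => ?_)
      (PowerFree.mem_shiftSpace_powers_iff fun m n hm => ?_)
    · have h1 : (12 * m : ℝ) ≤ β * m := by gcongr
      exact_mod_cast h1.trans (Nat.le_ceil _)
    · rw [Set.mem_Ici, le_div_iff₀ (by exact_mod_cast hm), Nat.ceil_le]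
  · intro hβ
    -- The least `n` with `n / m > β`; the strict inequality accounts for the `+ 1`.
    refine PowerFree.existsUnique_isMME (ℓ := fun m => ⌊β * m⌋₊ + 1) hd (fun m hm => ?_)
      (PowerFree.mem_shiftSpace_powers_iff fun m n hm => ?_)
    · have h1 : 12 * m ≤ ⌊β * m⌋₊ := by
        rw [Nat.le_floor_iff (by positivity)]
        push_cast
        gcongr
      omega
    · rw [Set.mem_Ioi, lt_div_iff₀ (by exact_mod_cast hm), Nat.succ_le_iff,
        Nat.floor_lt (by positivity)]
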